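/- Let $\Gamma=(G,E)$ be an infinite connected graph in which every vertex has at most $C_D$ neighbours, let $\mu_e>0$ $(e\in E)$ be conductances, and let $\nu$ be a measure on $G$ with $C_M^{-1}\le\nu_x=\nu(\{x\})\le C_M$ for all $x\in G$, where $C_M\ge 1$. Write $\mu_{xy}=\mu_{\{x,y\}}$ if $x\sim y$ and $\mu_{xy}=0$ otherwise, let $d(\cdot,\cdot)$ be the graph distance and $B(x,r)=\{y:d(x,y)<r\}$, and assume that for some real $d\ge1$, $C_V<\infty$ and $C_N>0$: (i) $\nu(B(x,r))\le C_V r^d$ for all $x\in G$, $r\ge1$; (ii) (Nash inequality) for every $f\in L^1(G,\nu)\cap L^2(G,\nu)$, $$\mathcal E(f,f):=\tfrac12\sum_x\sum_{y}\mu_{xy}(f(y)-f(x))^2\ \ge\ C_N\|f\|_2^{2+4/d}\,\|f\|_1^{-4/d},$$ where $\|f\|_p$ is the norm of $L^p(G,\nu)$. Let $X$ be the continuous time Markov chain on $G$ with generator $\mathcal Lf(x)=\nu_x^{-1}\sum_y\mu_{xy}(f(y)-f(x))$, killed at its explosion time (if it explodes), and let $q_t(x,y)=P^x(X_t=y)/\nu_y$.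 Fix $C_A\in(0,\infty)$, $\lambda\ge1$ and $\eta\in(0,1)$. Let $\tilde d(x,y)$ be the infimum of $\sum_{i=1}^n \big(C_A\wedge\mu_{e_i}^{-1/2}\big)$ over all paths $(e_1,\dots,e_n)$ from $x$ to $y$, and $\tilde B(x,r)=\{y:\tilde d(x,y)<r\}$. Say that $(x,r)$ is $\lambda$-good if $\tilde B(x,n/\lambda)\subset B(x,n)$ for all $n\in\mathbb N$ with $n\ge r$, and that $(x,R_0)$ is $\lambda$-very good if for all real $R\ge R_0$, all $y\in B(x,R)$ and all $r\in\mathbb N$ with $r\ge R^\eta$, the pair $(y,r)$ is $\lambda$-good. Let $V_x$ be the smallest $n\in\mathbb N$ such that $(x,n)$ is $\lambda$-very good ($V_x=\infty$ if there is none). **Theorem.** There are constants $c_1,c_2,c_3,c_4>0$, depending only on $C_A,C_D,C_M,C_V,C_N,d,\lambda,\eta$, such that the following holds. Let $x,y\in G$ and $t>0$, write $D=d(x,y)$, and suppose that either $D\ge c_1\vee V_x$ or $t\ge D^2$. (a) If $c_2D\le t$, then $q_t(x,y)\le c_3\,t^{-d/2}e^{-c_4D^2/t}$. (b) If $c_2D\ge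 t$, then $q_t(x,y)\le c_3\exp\big(-c_4D\,(1\vee\log(D/t))\big)$. -/

import Mathlib

open MeasureTheory ProbabilityTheory Set
open scoped ENNReal

universe u

noncomputable section

namespace WeightedGraph

variable {V : Type u} (Γ : SimpleGraph V) (μ : Sym2 V → ℝ)

/-- The conductance `μ_{xy}`: it is `μ_e` if `e = {x, y}` is an edge of `Γ`, and `0` otherwise. -/
def edgeWeight (x y : V) : ℝ := Γ.edgeSet.indicator μ s(x, y)

/-- `μ_x = ∑_y μ_{xy}`. -/
def vertexWeight (x : V) : ℝ := ∑' y, edgeWeight Γ μ x y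

/-- The ball `B(x, r) = {y : d(x, y) < r}` of the graph distance. -/
def ball (x : V) (r : ℝ) : Set V := {y | (Γ.dist x y : ℝ) < r}

/-- The waiting time `t(e) = C_A ∧ μ_e ^ (-1/2)` of an edge. -/
def waitingTime (CA : ℝ) (e : Sym2 V) : ℝ := min CA (μ e ^ (-(1 / 2) : ℝ))

/-- The first passage percolation metric: the infimum, over the paths from `x` to `y`, of the sum of
the waiting times of the edges of the path. -/
def fppDist (CA : ℝ) (x y : V) : ℝ :=
  ⨅ p : Γ.Walk x y, (p.edges.map (waitingTime μ CA)).sum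

/-- The ball of radius `r` around `x` of the first passage percolation metric. -/
def fppBall (CA : ℝ) (x : V) (r : ℝ) : Set V := {y | fppDist Γ μ CA x y < r}

/-- `(x, r)` is `lam`-good. -/
def IsGood (CA lam : ℝ) (x : V) (r : ℝ) : Prop :=
  ∀ n : ℕ, r ≤ n → fppBall Γ μ CA x (n / lam) ⊆ ball Γ x n

/-- `(x, R₀)` is `lam`-very good (with exponent `η`). -/
def IsVeryGood (CA lam η : ℝ) (x : V) (R₀ : ℝ) : Prop :=
  ∀ R : ℝ, R₀ ≤ R → ∀ y ∈ ball Γ x R, ∀ r : ℕ, R ^ η ≤ r → IsGood Γ μ CA lam y r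

/-- `V_x`, the smallest natural number `n` such that `(x, n)` is `lam`-very good, and `V_x = ∞` if
there is none. -/
def veryGoodRadius (CA lam η : ℝ) (x : V) : ℕ∞ :=
  ⨅ (n : ℕ) (_ : IsVeryGood Γ μ CA lam η x n), (n : ℕ∞)

variable [MeasurableSpace V] (ν : Measure V)

/-- The quadratic form `ℰ(f, f) = ½ ∑_x ∑_y μ_{xy} (f(y) - f(x))²`, with values in `[0, ∞]`. -/
def energy (f : V → ℝ) : ℝ≥0∞ :=
  2⁻¹ * ∑' x, ∑' y, ENNReal.ofReal (edgeWeight Γ μ x y * (f y - f x) ^ 2)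

/-- The jump rate `μ_x / ν_x` out of `x` of the Markov chain `X` with generator
`ℒ f(x) = ν_x⁻¹ ∑_y μ_{xy} (f(y) - f(x))`. -/
def jumpRate (x : V) : ℝ := vertexWeight Γ μ x / ν.real {x}

/-- The probability `P^x(X_t = y, X makes exactly n jumps in [0, t])` for the continuous time Markov
chain `X` with generator `ℒ`: started at `x`, the chain waits there an exponential time of rate
`μ_x / ν_x`, then jumps to `z` with probability `μ_{xz} / μ_x`, and starts afresh from `z`. -/
def jumpProb : ℕ → ℝ → V → V → ℝ≥0∞
  | 0, t, x, y => ({y} : Set V).indicator (fun x => expMeasure (jumpRate Γ μ ν x) (Ioi t)) x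
  | n + 1, t, x, y =>
      ∫⁻ s in Iic t,
        ∑' z, ENNReal.ofReal (edgeWeight Γ μ x z / vertexWeight Γ μ x) * jumpProb n (t - s) z y
        ∂(expMeasure (jumpRate Γ μ ν x))

/-- The transition probability `P^x(X_t = y)` of the chain, which is killed at its explosion time:
at time `t` the chain is alive exactly if it has made finitely many jumps. (This is the minimal
transition function of the generator `ℒ`, so `X` is the process of the Dirichlet form which is
the closure of `ℰ` on finitely supported functions.) -/
def transProb (t : ℝ) (x y : V) : ℝ≥0∞ := ∑' n, jumpProb Γ μ ν n t x y

/-- The heat kernel `q_t(x, y) = P^x(X_t = y) / ν_y`. -/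
def heatKernel (t : ℝ) (x y : V) : ℝ := (transProb Γ μ ν t x y).toReal / ν.real {y}

/-- `Γ` is connected, of vertex degree at most `CD`, the conductances of the edges are positive,
and `CM⁻¹ ≤ ν_x ≤ CM`. -/
structure IsAdmissible (CD : ℕ) (CM : ℝ) : Prop where
  connected : Γ.Connected
  degree_le : ∀ x, (Γ.neighborSet x).encard ≤ CD
  weight_pos : ∀ e ∈ Γ.edgeSet, 0 < μ e
  le_measure : ∀ x, ENNReal.ofReal CM⁻¹ ≤ ν {x}
  measure_le : ∀ x, ν {x} ≤ ENNReal.ofReal CM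

/-- Polynomial volume growth and the Nash inequality. -/
structure IsNash (d CV CN : ℝ) : Prop where
  volume_le : ∀ x, ∀ r : ℝ, 1 ≤ r → ν (ball Γ x r) ≤ ENNReal.ofReal (CV * r ^ d)
  nash : ∀ f : V → ℝ, MemLp f 1 ν → MemLp f 2 ν →
    ENNReal.ofReal CN * eLpNorm f 2 ν ^ (2 + 4 / d) * eLpNorm f 1 ν ^ (-(4 / d)) ≤ energy Γ μ f

end WeightedGraph

end

/-! The first passage metric d̃ is intrinsic for the chain. Across an edge it changes by at most C_A
∧ μ_e^(-1/2), so large conductances do no harm: for ρ = d̃(x₀, ·) one has ∑_y μ_{xy} cosh(s(ρ x - ρ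
y)) ≤ μ_x + K s² e^(s C_A) ν_x, with K depending only on C_D and C_M (`sum_weight_mul_cosh_le`).
Davies' method turns this into L² estimates weighted by e^(2sρ) (`weighted_bound`), while Nash's
differential inequality gives ‖q_t(x, ·)‖₂² ≤ C t^(-d/2) (`nash_bound`).

The weighted estimate alone yields exponential decay without the factor t^(-d/2). With s of order
log(D/t) this is already (b). For (a), let J(R, T) be the mass of q_T(x, ·)² on {ρ ≥ R}. Cutting the
kernel at time T' at level R' bounds J(R, T) by 2 J(R', T') plus a Davies error that carries
T'^(-d/2). Iterating with R' = 4R/5, T' = T/2 until R is comparable to T gives a Gaussian tail with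
the right prefactor (`exists_gaussian_tail`). Chapman–Kolmogorov at the midpoint turns tails into a
pointwise bound, because every intermediate vertex is far from x or far from y.

The analysis takes place on finite chains, killed on leaving a finite set A: their semigroups are
matrix exponentials, they inherit the Nash inequality through extension by zero, and no constant
depends on A. A path with at most n jumps stays in the n-step neighbourhood of its start, so bounds
for the killed kernels pass to q_t (`heatKernel_le`).

Finally, D ≥ V_x makes (x, D) good, hence d̃(x, y) ≥ D/λ (`div_le_fppDist`). If instead t ≥ D², the
Gaussian factor is bounded below and the on-diagonal bound suffices. -/

/-! ### Finite Markov chains with killing -/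

namespace FiniteChain

variable {ι : Type u} [Fintype ι] (m k : ι → ℝ) (w : ι → ι → ℝ)

/-- The generator `f ↦ m⁻¹ (∑ y, w x y f y - k x f x)` of a finite chain with symmetric weights `w`,
reference measure `m` and total weights `k`. -/
noncomputable def generator : (ι → ℝ) →L[ℝ] (ι → ℝ) :=
  LinearMap.toContinuousLinearMap
    { toFun := fun f x => (∑ y, w x y * f y - k x * f x) / m x
      map_add' := fun f g => by
        ext x
        simp only [Pi.add_apply, mul_add, Finset.sum_add_distrib]
        ring
      map_smul' := fun c f => by
        ext x
        simp only [Pi.smul_apply, smul_eq_mul, RingHom.id_apply, mul_left_comm _ c,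
          ← Finset.mul_sum]
        ring }

lemma generator_apply (f : ι → ℝ) (x : ι) :
    generator m k w f x = (∑ y, w x y * f y - k x * f x) / m x := rfl

/-- The semigroup of a finite chain. -/
noncomputable def semigroup (t : ℝ) : (ι → ℝ) →L[ℝ] (ι → ℝ) :=
  NormedSpace.exp (t • generator m k w)

lemma semigroup_zero : semigroup m k w 0 = 1 := by
  simp [semigroup]

lemma semigroup_add (s t : ℝ) :
    semigroup m k w (s + t) = semigroup m k w s * semigroup m k w t := by
  let := NormedAlgebra.restrictScalars ℚ ℝ ((ι → ℝ) →L[ℝ] (ι → ℝ))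
  rw [semigroup, add_smul]
  exact NormedSpace.exp_add_of_commute
    (((Commute.refl (generator m k w)).smul_left s).smul_right t)

lemma semigroup_add_apply (s t : ℝ) (f : ι → ℝ) :
    semigroup m k w (s + t) f = semigroup m k w s (semigroup m k w t f) := by
  rw [semigroup_add]; rfl

lemma hasDerivAt_semigroup (f : ι → ℝ) (t : ℝ) :
    HasDerivAt (fun t => semigroup m k w t f)
      (generator m k w (semigroup m k w t f)) t :=
  (hasDerivAt_exp_smul_const' (generator m k w) t).clm_apply (hasDerivAt_const t f) |>.congr_deriv
    (by simp [semigroup])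

lemma hasDerivAt_semigroup_apply (f : ι → ℝ) (t : ℝ) (x : ι) :
    HasDerivAt (fun t => semigroup m k w t f x)
      (generator m k w (semigroup m k w t f) x) t :=
  hasDerivAt_pi.1 (hasDerivAt_semigroup m k w f t) x

/-- The generator is bounded, so time can be run backwards. This keeps the L² norm in Nash's
differential inequality strictly positive. -/
lemma semigroup_injective (t : ℝ) : Function.Injective (semigroup m k w t) := by
  intro f g h
  have := congrArg (semigroup m k w (-t)) h
  simpa [← semigroup_add_apply, semigroup_zero] using this

variable {m k w}

lemma hasSum_semigroup_apply (t : ℝ) (T : (ι → ℝ) →L[ℝ] (ι → ℝ)) (f : ι → ℝ) (x : ι) :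
    HasSum (fun n : ℕ => ((n.factorial : ℝ)⁻¹ * t ^ n) * (T ^ n) f x)
      (NormedSpace.exp (t • T) f x) := by
  have h := NormedSpace.exp_series_hasSum_exp' (𝕂 := ℝ) (t • T)
  have h2 := (ContinuousLinearMap.apply ℝ (ι → ℝ) f).hasSum h
  have h3 := (ContinuousLinearMap.proj (R := ℝ) (φ := fun _ : ι => ℝ) x).hasSum h2
  refine h3.congr_fun ?_ |> fun h => h
  intro n
  simp [smul_pow, mul_assoc]

/-- The standing assumptions on a finite chain. -/
structure IsChain (m k : ι → ℝ) (w : ι → ι → ℝ) : Prop where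
  pos : ∀ x, 0 < m x
  nonneg : ∀ x y, 0 ≤ w x y
  symm : ∀ x y, w x y = w y x
  sum_le : ∀ x, ∑ y, w x y ≤ k x

lemma IsChain.sum_mul_generator (h : IsChain m k w) (f g : ι → ℝ) :
    ∑ x, m x * (g x * generator m k w f x) =
      ∑ x, ∑ y, w x y * (g x * f y) - ∑ x, k x * (g x * f x) := by
  rw [← Finset.sum_sub_distrib]
  refine Finset.sum_congr rfl fun x _ => ?_
  rw [generator_apply]
  have := (h.pos x).ne'
  have e : m x * (g x * ((∑ y, w x y * f y - k x * f x) / m x))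
      = g x * ∑ y, w x y * f y - k x * (g x * f x) := by field_simp
  rw [e, Finset.mul_sum]
  congr 1
  exact Finset.sum_congr rfl fun y _ => by ring

lemma IsChain.generator_symm (h : IsChain m k w) (f g : ι → ℝ) :
    ∑ x, m x * (g x * generator m k w f x) = ∑ x, m x * (f x * generator m k w g x) := by
  rw [h.sum_mul_generator, h.sum_mul_generator, Finset.sum_comm]
  congr 1
  · exact Finset.sum_congr rfl fun x _ => Finset.sum_congr rfl fun y _ => by
      rw [h.symm y x]; ring
  · exact Finset.sum_congr rfl fun x _ => by ring

/-- Symmetry passes from the generator to its powers, and from these to the exponential series. -/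
lemma IsChain.semigroup_symm (h : IsChain m k w) (t : ℝ) (f g : ι → ℝ) :
    ∑ x, m x * (g x * semigroup m k w t f x) = ∑ x, m x * (f x * semigroup m k w t g x) := by
  have key : ∀ (n : ℕ) (f g : ι → ℝ), ∑ x, m x * (g x * (generator m k w ^ n) f x)
      = ∑ x, m x * (f x * (generator m k w ^ n) g x) := by
    intro n
    induction n with
    | zero => intro f g; simp [mul_comm (f _)]
    | succ n ih =>
      intro f g
      have e1 : (generator m k w ^ (n + 1)) f
        = generator m k w ((generator m k w ^ n) f) := by rw [pow_succ']; rfl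
      have e2 : (generator m k w ^ (n + 1)) g
        = (generator m k w ^ n) (generator m k w g) := by rw [pow_succ]; rfl
      rw [e1, e2, h.generator_symm, ← ih]
      exact Finset.sum_congr rfl fun x _ => by ring
  have s (f g : ι → ℝ) := hasSum_sum (s := Finset.univ) fun x _ =>
    ((hasSum_semigroup_apply t (generator m k w) f x).mul_left (g x)).mul_left (m x)
  refine (s f g).unique ?_
  rw [semigroup]
  convert s g f using 1
  funext n
  have e : ∀ f g : ι → ℝ, ∑ x, m x * (g x * (((n.factorial : ℝ)⁻¹ * t ^ n) *
      (generator m k w ^ n) f x)) =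
      ((n.factorial : ℝ)⁻¹ * t ^ n) * ∑ x, m x * (g x * (generator m k w ^ n) f x) := by
    intro f g
    rw [Finset.mul_sum]
    exact Finset.sum_congr rfl fun x _ => by ring
  rw [e f g, e g f, key]

/-- For c ≥ max k/m the operator T = generator + c preserves nonnegativity, and the semigroup is
e^(-ct) times a power series in T with nonnegative coefficients. -/
lemma IsChain.semigroup_nonneg (h : IsChain m k w) {t : ℝ} (ht : 0 ≤ t) {f : ι → ℝ}
    (hf : ∀ x, 0 ≤ f x) (x : ι) : 0 ≤ semigroup m k w t f x := by
  obtain ⟨c, hc⟩ : ∃ c : ℝ, ∀ x, k x / m x ≤ c := by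
    obtain ⟨c, hc⟩ := (Set.finite_range fun x => k x / m x).bddAbove
    exact ⟨c, fun x => hc ⟨x, rfl⟩⟩
  set T : (ι → ℝ) →L[ℝ] (ι → ℝ) := generator m k w + c • 1 with hT
  have hTpos : ∀ n : ℕ, ∀ x, 0 ≤ (T ^ n) f x := by
    intro n
    induction n with
    | zero => simpa using hf
    | succ n ih =>
      intro x
      have e1 : (T ^ (n + 1)) f = T ((T ^ n) f) := by rw [pow_succ']; rfl
      rw [e1]
      have e2 : T ((T ^ n) f) x = (∑ y, w x y * (T ^ n) f y) / m x
          + (c - k x / m x) * (T ^ n) f x := by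
        rw [hT]
        simp only [add_apply, smul_apply,
          one_apply_eq_self, Pi.add_apply, Pi.smul_apply, smul_eq_mul, generator_apply]
        ring
      rw [e2]
      exact add_nonneg (div_nonneg (Finset.sum_nonneg fun y _ => mul_nonneg (h.nonneg x y) (ih y))
        (h.pos x).le) (mul_nonneg (sub_nonneg.2 (hc x)) (ih x))
  have e : semigroup m k w t = Real.exp (-(c * t)) • NormedSpace.exp (t • T) := by
    let := NormedAlgebra.restrictScalars ℚ ℝ ((ι → ℝ) →L[ℝ] (ι → ℝ))
    have e1 : t • generator m k w = t • T + (-(c * t)) • (1 : (ι → ℝ) →L[ℝ] (ι → ℝ)) := by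
      rw [hT]; module
    rw [semigroup, e1, NormedSpace.exp_add_of_commute ((Commute.one_right _).smul_right _)]
    have e2 : NormedSpace.exp ((-(c * t)) • (1 : (ι → ℝ) →L[ℝ] (ι → ℝ)))
        = Real.exp (-(c * t)) • 1 := by
      rw [← Algebra.algebraMap_eq_smul_one, ← Algebra.algebraMap_eq_smul_one, Real.exp_eq_exp_ℝ,
        NormedSpace.algebraMap_exp_comm]
    rw [e2]
    simp
  rw [e]
  refine mul_nonneg (Real.exp_pos _).le ?_
  exact (hasSum_semigroup_apply t T f x).nonneg fun n => mul_nonneg (by positivity) (hTpos n x)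

lemma antitoneOn_Ici_of_hasDerivAt_nonpos {u u' : ℝ → ℝ} (hu : ∀ t, HasDerivAt u (u' t) t)
    (h : ∀ t, 0 ≤ t → u' t ≤ 0) {t : ℝ} (ht : 0 ≤ t) : u t ≤ u 0 := by
  refine antitoneOn_of_deriv_nonpos (convex_Ici 0)
    (fun x _ => (hu x).continuousAt.continuousWithinAt)
    (fun x _ => (hu x).differentiableAt.differentiableWithinAt) (fun x hx => ?_)
    self_mem_Ici (mem_Ici.2 ht) ht
  rw [interior_Ici] at hx
  rw [(hu x).deriv]
  exact h x (le_of_lt hx)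

/-- The total mass changes at the rate ∑_y (∑_x w x y - k y) u_y ≤ 0: killing only removes mass. -/
lemma IsChain.sum_semigroup_le (h : IsChain m k w) {t : ℝ} (ht : 0 ≤ t) {f : ι → ℝ}
    (hf : ∀ x, 0 ≤ f x) : ∑ x, m x * semigroup m k w t f x ≤ ∑ x, m x * f x := by
  have hd : ∀ t, HasDerivAt (fun t => ∑ x, m x * semigroup m k w t f x)
      (∑ x, m x * generator m k w (semigroup m k w t f) x) t := fun t =>
    HasDerivAt.fun_sum fun x _ => (hasDerivAt_semigroup_apply m k w f t x).const_mul (m x)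
  have := antitoneOn_Ici_of_hasDerivAt_nonpos hd (fun t ht => ?_) ht
  · simpa [semigroup_zero] using this
  · have e := h.sum_mul_generator (semigroup m k w t f) (fun _ => 1)
    simp only [one_mul] at e
    rw [e, Finset.sum_comm, ← Finset.sum_sub_distrib]
    refine Finset.sum_nonpos fun y _ => ?_
    rw [← Finset.sum_mul, ← sub_mul]
    refine mul_nonpos_of_nonpos_of_nonneg ?_ (h.semigroup_nonneg ht hf y)
    rw [Finset.sum_congr rfl fun x _ => h.symm x y]
    linarith [h.sum_le y]

/-- Exponentially weighted `L²` bound (Davies' perturbation method). -/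
lemma IsChain.weighted_bound (h : IsChain m k w) {ρ : ι → ℝ} {s κ : ℝ}
    (hρ : ∀ x, ∑ y, w x y * Real.cosh (s * (ρ x - ρ y)) ≤ k x + κ * m x)
    {t : ℝ} (ht : 0 ≤ t) (f : ι → ℝ) :
    ∑ x, m x * (Real.exp (2 * s * ρ x) * semigroup m k w t f x ^ 2) ≤
      Real.exp (2 * κ * t) * ∑ x, m x * (Real.exp (2 * s * ρ x) * f x ^ 2) := by
  have hd : ∀ t, HasDerivAt (fun t => Real.exp (-(2 * κ * t)) *
      ∑ x, m x * (Real.exp (2 * s * ρ x) * semigroup m k w t f x ^ 2))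
      (Real.exp (-(2 * κ * t)) * (2 * (∑ x, m x * ((Real.exp (2 * s * ρ x) *
        semigroup m k w t f x) * generator m k w (semigroup m k w t f) x)
        - κ * ∑ x, m x * (Real.exp (2 * s * ρ x) * semigroup m k w t f x ^ 2)))) t := by
    intro t
    have h1 : HasDerivAt (fun t => Real.exp (-(2 * κ * t)))
        (Real.exp (-(2 * κ * t)) * (-(2 * κ * 1))) t :=
      (((hasDerivAt_id t).const_mul (2 * κ)).neg).exp
    have h2 : HasDerivAt (fun t => ∑ x, m x * (Real.exp (2 * s * ρ x) *
        semigroup m k w t f x ^ 2))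
        (∑ x, m x * (Real.exp (2 * s * ρ x) * (((2 : ℕ) : ℝ) * semigroup m k w t f x ^ (2 - 1) *
          generator m k w (semigroup m k w t f) x))) t :=
      HasDerivAt.fun_sum fun x _ => (((hasDerivAt_semigroup_apply m k w f t x).fun_pow 2).const_mul
        (Real.exp (2 * s * ρ x))).const_mul (m x)
    refine (h1.mul h2).congr_deriv ?_
    have e : ∑ x, m x * (Real.exp (2 * s * ρ x) * (((2 : ℕ) : ℝ) * semigroup m k w t f x ^ (2 - 1) *
          generator m k w (semigroup m k w t f) x)) = 2 * ∑ x, m x * ((Real.exp (2 * s * ρ x) *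
        semigroup m k w t f x) * generator m k w (semigroup m k w t f) x) := by
      rw [Finset.mul_sum]
      exact Finset.sum_congr rfl fun x _ => by norm_num; ring
    rw [e]
    ring
  have key := antitoneOn_Ici_of_hasDerivAt_nonpos hd (fun t _ => ?_) ht
  · simp only [semigroup_zero, mul_zero, neg_zero, Real.exp_zero, one_mul,
      one_apply_eq_self] at key
    rw [Real.exp_neg, inv_mul_le_iff₀ (Real.exp_pos _)] at key
    exact key
  · refine mul_nonpos_of_nonneg_of_nonpos (Real.exp_pos _).le ?_
    suffices H : ∑ x, m x * ((Real.exp (2 * s * ρ x) *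
        semigroup m k w t f x) * generator m k w (semigroup m k w t f) x)
        ≤ κ * ∑ x, m x * (Real.exp (2 * s * ρ x) * semigroup m k w t f x ^ 2) by linarith
    generalize semigroup m k w t f = F
    rw [h.sum_mul_generator, sub_le_iff_le_add]
    -- Conjugation by e^(sρ): in terms of g the off-diagonal form has weights w e^(s(ρ x - ρ y)).
    -- Symmetrizing in x and y replaces the exponential by cosh, and g x g y ≤ (g x² + g y²)/2 then
    -- reduces to the hypothesis on row sums.
    set g : ι → ℝ := fun x => Real.exp (s * ρ x) * F x with hg
    have hexp : ∀ x, Real.exp (2 * s * ρ x) = Real.exp (s * ρ x) * Real.exp (s * ρ x) := by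
      intro x; rw [← Real.exp_add]; congr 1; ring
    have hgg : ∀ x, Real.exp (2 * s * ρ x) * F x ^ 2 = g x ^ 2 := by
      intro x; rw [hexp, hg]; ring
    have e1 : ∀ x y, Real.exp (2 * s * ρ x) * F x * F y
        = Real.exp (s * (ρ x - ρ y)) * (g x * g y) := by
      intro x y
      have : Real.exp (s * (ρ x - ρ y)) * Real.exp (s * ρ y) = Real.exp (s * ρ x) := by
        rw [← Real.exp_add]; congr 1; ring
      rw [hexp, hg]
      linear_combination (-Real.exp (s * ρ x) * F x * F y) * this
    have e2 : ∑ x, ∑ y, w x y * (Real.exp (2 * s * ρ x) * F x * F y)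
        = ∑ x, ∑ y, w x y * Real.cosh (s * (ρ x - ρ y)) * (g x * g y) := by
      have a : ∑ x, ∑ y, w x y * (Real.exp (s * (ρ x - ρ y)) * (g x * g y))
          = ∑ x, ∑ y, w x y * (Real.exp (-(s * (ρ x - ρ y))) * (g x * g y)) := by
        rw [Finset.sum_comm]
        refine Finset.sum_congr rfl fun x _ => Finset.sum_congr rfl fun y _ => ?_
        rw [h.symm y x, mul_comm (g y), show s * (ρ y - ρ x) = -(s * (ρ x - ρ y)) by ring]
      have b : ∑ x, ∑ y, w x y * Real.cosh (s * (ρ x - ρ y)) * (g x * g y)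
          = (∑ x, ∑ y, w x y * (Real.exp (s * (ρ x - ρ y)) * (g x * g y))
          + ∑ x, ∑ y, w x y * (Real.exp (-(s * (ρ x - ρ y))) * (g x * g y))) / 2 := by
        rw [← Finset.sum_add_distrib, Finset.sum_div]
        refine Finset.sum_congr rfl fun x _ => ?_
        rw [← Finset.sum_add_distrib, Finset.sum_div]
        refine Finset.sum_congr rfl fun y _ => ?_
        rw [Real.cosh_eq]; ring
      rw [b, ← a]
      simp only [e1]
      ring
    have e3 : ∑ x, ∑ y, w x y * Real.cosh (s * (ρ x - ρ y)) * (g x * g y)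
        ≤ ∑ x, ∑ y, w x y * Real.cosh (s * (ρ x - ρ y)) * g x ^ 2 := by
      have a : ∑ x, ∑ y, w x y * Real.cosh (s * (ρ x - ρ y)) * g x ^ 2
          = ∑ x, ∑ y, w x y * Real.cosh (s * (ρ x - ρ y)) * g y ^ 2 := by
        rw [Finset.sum_comm]
        refine Finset.sum_congr rfl fun x _ => Finset.sum_congr rfl fun y _ => ?_
        rw [h.symm y x, show s * (ρ y - ρ x) = -(s * (ρ x - ρ y)) by ring, Real.cosh_neg]
      have b : ∑ x, ∑ y, w x y * Real.cosh (s * (ρ x - ρ y)) * (g x * g y)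
          ≤ ∑ x, ∑ y, (w x y * Real.cosh (s * (ρ x - ρ y)) * g x ^ 2 +
            w x y * Real.cosh (s * (ρ x - ρ y)) * g y ^ 2) / 2 := by
        refine Finset.sum_le_sum fun x _ => Finset.sum_le_sum fun y _ => ?_
        have : 0 ≤ w x y * Real.cosh (s * (ρ x - ρ y)) :=
          mul_nonneg (h.nonneg x y) (Real.cosh_pos _).le
        nlinarith [mul_nonneg this (sq_nonneg (g x - g y))]
      refine b.trans (le_of_eq ?_)
      simp only [← Finset.sum_div, Finset.sum_add_distrib]
      rw [← a]
      ring
    rw [e2]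
    refine e3.trans ?_
    rw [Finset.mul_sum, ← Finset.sum_add_distrib]
    refine Finset.sum_le_sum fun x _ => ?_
    rw [← Finset.sum_mul, hgg]
    have e4 : k x * (Real.exp (2 * s * ρ x) * F x * F x) = k x * g x ^ 2 := by
      rw [← hgg]; ring
    rw [e4]
    nlinarith [mul_le_mul_of_nonneg_right (hρ x) (sq_nonneg (g x))]

lemma IsChain.sum_sq_semigroup_le (h : IsChain m k w) {t : ℝ} (ht : 0 ≤ t) (f : ι → ℝ) :
    ∑ x, m x * semigroup m k w t f x ^ 2 ≤ ∑ x, m x * f x ^ 2 := by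
  have := h.weighted_bound (ρ := fun _ => 0) (s := 0) (κ := 0) (by simpa using h.sum_le) ht f
  simpa using this

/-- The Nash inequality gives the on-diagonal bound. -/
lemma IsChain.nash_bound (h : IsChain m k w) {d C : ℝ} (hd : 1 ≤ d) (hC : 0 < C)
    (nash : ∀ f : ι → ℝ, ∑ x, m x * |f x| ≤ 1 →
      C * (∑ x, m x * f x ^ 2) ^ (1 + 2 / d) ≤
        ∑ x, k x * (f x * f x) - ∑ x, ∑ y, w x y * (f x * f y))
    {f : ι → ℝ} (hf : ∀ x, 0 ≤ f x) (hf1 : ∑ x, m x * f x ≤ 1) {t : ℝ} (ht : 0 < t) :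
    ∑ x, m x * semigroup m k w t f x ^ 2 ≤ (4 * C / d) ^ (-(d / 2)) * t ^ (-(d / 2)) := by
  have hd0 : 0 < d := by linarith
  by_cases hf0 : f = 0
  · subst hf0
    simp only [map_zero, Pi.zero_apply]
    rw [Finset.sum_eq_zero (by simp)]
    positivity
  set u : ℝ → ℝ := fun t => ∑ x, m x * semigroup m k w t f x ^ 2 with hu
  set u' : ℝ → ℝ := fun t => 2 * ∑ x, m x * (semigroup m k w t f x *
      generator m k w (semigroup m k w t f) x) with hu'
  have hupos : ∀ t, 0 < u t := by
    intro t
    have hne : semigroup m k w t f ≠ 0 := fun h0 =>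
      hf0 (semigroup_injective m k w t (by rw [h0, map_zero]))
    obtain ⟨x, hx⟩ := Function.ne_iff.1 hne
    exact Finset.sum_pos' (fun y _ => mul_nonneg (h.pos y).le (sq_nonneg _))
      ⟨x, Finset.mem_univ x, mul_pos (h.pos x) (by simpa using pow_pos (abs_pos.2 hx) 2)⟩
  have hderiv : ∀ t, HasDerivAt u (u' t) t := by
    intro t
    refine (HasDerivAt.fun_sum fun x _ => ((hasDerivAt_semigroup_apply m k w f t x).fun_pow
      2).const_mul (m x)).congr_deriv ?_
    simp only [hu', Finset.mul_sum]
    exact Finset.sum_congr rfl fun x _ => by norm_num; ring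
  have hineq : ∀ t, 0 ≤ t → u' t ≤ -(2 * C) * u t ^ (1 + 2 / d) := by
    intro t ht
    have h1 : ∑ x, m x * |semigroup m k w t f x| ≤ 1 := by
      simp only [fun x => abs_of_nonneg (h.semigroup_nonneg ht hf x)]
      exact (h.sum_semigroup_le ht hf).trans hf1
    have h2 := nash _ h1
    simp only [hu', hu]
    rw [h.sum_mul_generator]
    linarith
  -- The inequality u' ≤ -2C u^(1 + 2/d) linearizes for u^(-2/d), whose derivative is at least 4C/d.
  have hv : ∀ t, HasDerivAt (fun t => u t ^ (-(2 / d))) (u' t * (-(2 / d)) * u t ^ (-(2 / d) - 1))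
      t := fun t => (hderiv t).rpow_const (Or.inl (hupos t).ne')
  have hmv : 4 * C / d * (t - 0) ≤ u t ^ (-(2 / d)) - u 0 ^ (-(2 / d)) := by
    refine Convex.mul_sub_le_image_sub_of_le_deriv (convex_Ici 0)
      (fun x _ => (hv x).continuousAt.continuousWithinAt)
      (fun x _ => (hv x).differentiableAt.differentiableWithinAt) (fun x hx => ?_)
      0 self_mem_Ici t (mem_Ici.2 ht.le) ht.le
    rw [interior_Ici] at hx
    rw [(hv x).deriv]
    have h1 := hineq x (le_of_lt hx)
    have h2 : u x ^ (1 + 2 / d) * u x ^ (-(2 / d) - 1) = 1 := by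
      rw [← Real.rpow_add (hupos x)]; ring_nf; exact Real.rpow_zero _
    have h3 : 0 < u x ^ (-(2 / d) - 1) := Real.rpow_pos_of_pos (hupos x) _
    have h4 : 2 / d * (2 * C * (u x ^ (1 + 2 / d) * u x ^ (-(2 / d) - 1)))
        ≤ u' x * (-(2 / d)) * u x ^ (-(2 / d) - 1) := by
      have h5 := mul_le_mul_of_nonneg_left (mul_le_mul_of_nonneg_right h1 h3.le)
        (by positivity : 0 ≤ 2 / d)
      linarith
    rw [h2] at h4
    refine le_trans (le_of_eq ?_) h4
    ring
  have hb : 4 * C / d * t ≤ u t ^ (-(2 / d)) := by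
    have := Real.rpow_pos_of_pos (hupos 0) (-(2 / d))
    linarith
  have e : u t = (u t ^ (-(2 / d))) ^ (-(d / 2)) := by
    rw [← Real.rpow_mul (hupos t).le]
    have : -(2 / d) * -(d / 2) = 1 := by field_simp
    rw [this, Real.rpow_one]
  change u t ≤ _
  rw [e, ← Real.mul_rpow (by positivity) ht.le]
  exact Real.rpow_le_rpow_of_nonpos (by positivity) hb (by linarith)

end FiniteChain

/-! ### From a recursive tail estimate to a Gaussian tail -/

/-- Raise v ≤ e^v, with v = bT/p, to the power p. This trades part of an exponential decay in T for
the factor T^(-d/2). -/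
lemma rpow_mul_exp_neg_le {p b T : ℝ} (hp : 0 < p) (hb : 0 < b) (hT : 0 < T) :
    T ^ p * Real.exp (-(b * T)) ≤ (p / b) ^ p := by
  have h1 : b * T / p ≤ Real.exp (b * T / p) := by linarith [Real.add_one_le_exp (b * T / p)]
  have h2 : (b * T / p) ^ p ≤ Real.exp (b * T) := by
    refine (Real.rpow_le_rpow (by positivity) h1 hp.le).trans (le_of_eq ?_)
    rw [← Real.exp_mul]
    congr 1
    field_simp
  have h3 : T ^ p = (p / b) ^ p * (b * T / p) ^ p := by
    rw [← Real.mul_rpow (by positivity) (by positivity)]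
    congr 1
    field_simp
  rw [Real.exp_neg, ← div_eq_mul_inv, div_le_iff₀ (Real.exp_pos _), h3]
  gcongr

set_option maxHeartbeats 1000000 in
/-- The constants of `exists_gaussian_tail` do not depend on the function `J`. -/
theorem exists_gaussian_tail {K A C₁ M d a : ℝ} (hK : 0 < K) (hA : 0 < A) (hC₁ : 0 < C₁)
    (hM : 0 < M) (hd : 0 < d) (ha : 0 < a) :
    ∃ B c : ℝ, 0 < B ∧ 0 < c ∧ ∀ J : ℝ → ℝ → ℝ,
      (∀ R T, 0 < T → J R T ≤ C₁ * T ^ (-(d / 2))) →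
      (∀ R T s, 0 < T → 0 ≤ s →
        J R T ≤ M * Real.exp (-(2 * s * R) + 2 * (K * s ^ 2 * Real.exp (s * A)) * T)) →
      (∀ R R' T T' s, R' ≤ R → 0 < T' → T' < T → 0 ≤ s →
        J R T ≤ 2 * J R' T' + 2 * (Real.exp (-(2 * s * (R - R')) +
          2 * (K * s ^ 2 * Real.exp (s * A)) * (T - T')) * (C₁ * T' ^ (-(d / 2))))) →
      ∀ R T, 0 < T → 0 ≤ R → R ≤ a * T →
        J R T ≤ B * T ^ (-(d / 2)) * Real.exp (-(c * (R ^ 2 / T))) := by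
  -- `ε` is the slope used in one step of the recursion, `σ` the slope used at its end
  set K' : ℝ := K * Real.exp (a * A) with hK'
  have hK'0 : 0 < K' := by positivity
  set ε : ℝ := min 1 (1 / (5 * K')) with hε
  have hε0 : 0 < ε := lt_min one_pos (by positivity)
  have hε1 : ε ≤ 1 := min_le_left _ _
  have hεK : K' * ε ≤ 1 / 5 := by
    have : ε ≤ 1 / (5 * K') := min_le_right _ _
    calc K' * ε ≤ K' * (1 / (5 * K')) := by gcongr
      _ = 1 / 5 := by field_simp
  set σ : ℝ := min 1 (a / (4 * (K * Real.exp A))) with hσ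
  have hσ0 : 0 < σ := lt_min one_pos (by positivity)
  have hσ1 : σ ≤ 1 := min_le_left _ _
  have hσK : K * Real.exp A * σ ≤ a / 4 := by
    have : σ ≤ a / (4 * (K * Real.exp A)) := min_le_right _ _
    calc K * Real.exp A * σ ≤ K * Real.exp A * (a / (4 * (K * Real.exp A))) := by gcongr
      _ = a / 4 := by field_simp
  -- The rate ε/5 is what one recursion step leaves; σ/(2a) is what its end allows, where R ≤ aT
  -- gives R²/T ≤ aR.
  set c : ℝ := min (ε / 5) (σ / (2 * a)) with hc
  have hc0 : 0 < c := lt_min (by positivity) (by positivity)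
  have hcε : c ≤ ε / 5 := min_le_left _ _
  have hcσ : c ≤ σ / (2 * a) := min_le_right _ _
  set θ : ℝ := (2 : ℝ) ^ (d / 2) with hθ
  have hθ1 : 1 ≤ θ := Real.one_le_rpow (by norm_num) (by positivity)
  have hθ0 : 0 < θ := by linarith
  -- One step multiplies X = R²/T by 0.8² · 2 = 1.28. For X ≥ X₀ the resulting gain e^(-0.28 c X)
  -- beats the loss 2θ caused by the factor 2 and by halving T; for X ≤ X₀ the on-diagonal bound is
  -- enough.
  set X₀ : ℝ := Real.log (4 * θ) / (0.28 * c) with hX₀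
  have hX₀c : 2 * θ * Real.exp (-(0.28 * c * X₀)) = 1 / 2 := by
    have : 0.28 * c * X₀ = Real.log (4 * θ) := by rw [hX₀]; field_simp
    rw [this, Real.exp_neg, Real.exp_log (by positivity)]
    field_simp
    norm_num
  set C₂ : ℝ := (d / 2 / (σ * a / 4)) ^ (d / 2) with hC₂
  have hC₂0 : 0 < C₂ := by positivity
  -- One summand for each source: the recursion error, the range R ≥ aT/2, and the range X ≤ X₀.
  set B : ℝ := 4 * θ * C₁ + M * C₂ + C₁ * Real.exp (c * X₀) with hB
  have hB0 : 0 < B := by positivity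
  have hB1 : 4 * θ * C₁ ≤ B := by
    have h1 : 0 < M * C₂ := by positivity
    have h2 : 0 < C₁ * Real.exp (c * X₀) := by positivity
    linarith
  have hB2 : M * C₂ ≤ B := by
    have h1 : 0 < 4 * θ * C₁ := by positivity
    have h2 : 0 < C₁ * Real.exp (c * X₀) := by positivity
    linarith
  have hB3 : C₁ * Real.exp (c * X₀) ≤ B := by
    have h1 : 0 < 4 * θ * C₁ := by positivity
    have h2 : 0 < M * C₂ := by positivity
    linarith
  clear_value B C₂ X₀ θ c σ ε K'
  refine ⟨B, c, hB0, hc0, fun J J₁ J₂ J₃ => ?_⟩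
  -- Passing to (0.8 R, T/2) multiplies R/T by 8/5, so n bounds the number of steps until R ≥ aT/2.
  have main : ∀ n : ℕ, ∀ R T, 0 < T → a * T / 2 * (5 / 8) ^ n ≤ R → R ≤ a * T →
      J R T ≤ B * T ^ (-(d / 2)) * Real.exp (-(c * (R ^ 2 / T))) := by
    intro n
    induction n with
    | zero =>
      intro R T hT hR hR'
      rw [pow_zero, mul_one] at hR
      have hR0 : 0 < R := lt_of_lt_of_le (by positivity) hR
      refine (J₂ R T σ hT hσ0.le).trans ?_
      have h1 : K * σ ^ 2 * Real.exp (σ * A) * T ≤ σ * R / 2 := by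
        have : Real.exp (σ * A) ≤ Real.exp A := Real.exp_le_exp.2 (by nlinarith)
        calc K * σ ^ 2 * Real.exp (σ * A) * T ≤ K * σ ^ 2 * Real.exp A * T := by gcongr
          _ = σ * (K * Real.exp A * σ) * T := by ring
          _ ≤ σ * (a / 4) * T := by gcongr
          _ = σ * (a * T / 2) / 2 := by ring
          _ ≤ σ * R / 2 := by gcongr
      have h2 : c * (R ^ 2 / T) ≤ σ * R / 2 := by
        calc c * (R ^ 2 / T) ≤ σ / (2 * a) * (R * (a * T) / T) := by
              gcongr
              nlinarith
          _ = σ * R / 2 := by field_simp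
      have h3 : σ * a / 4 * T ≤ σ * R / 2 := by nlinarith
      have h4 := rpow_mul_exp_neg_le (p := d / 2) (b := σ * a / 4) (by positivity)
        (by positivity) hT
      have h5 : Real.exp (-(σ * a / 4 * T)) ≤ C₂ * T ^ (-(d / 2)) := by
        rw [Real.rpow_neg hT.le, ← div_eq_mul_inv, le_div_iff₀ (by positivity), mul_comm, hC₂]
        exact h4
      calc M * Real.exp (-(2 * σ * R) + 2 * (K * σ ^ 2 * Real.exp (σ * A)) * T)
          ≤ M * Real.exp (-(σ * a / 4 * T) + -(c * (R ^ 2 / T))) := by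
            refine mul_le_mul_of_nonneg_left (Real.exp_le_exp.2 ?_) hM.le
            linarith
        _ = M * (Real.exp (-(σ * a / 4 * T)) * Real.exp (-(c * (R ^ 2 / T)))) := by
            rw [Real.exp_add]
        _ ≤ M * (C₂ * T ^ (-(d / 2)) * Real.exp (-(c * (R ^ 2 / T)))) := by gcongr
        _ = M * C₂ * T ^ (-(d / 2)) * Real.exp (-(c * (R ^ 2 / T))) := by ring
        _ ≤ _ := by gcongr
    | succ n ih =>
      intro R T hT hR hR'
      have hR0 : 0 < R := lt_of_lt_of_le (by positivity) hR
      set X : ℝ := R ^ 2 / T with hX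
      have hTpow : 0 < T ^ (-(d / 2)) := Real.rpow_pos_of_pos hT _
      rcases le_or_gt X X₀ with hXX | hXX
      · refine (J₁ R T hT).trans ?_
        have : 1 ≤ Real.exp (c * X₀) * Real.exp (-(c * X)) := by
          rw [← Real.exp_add]
          exact Real.one_le_exp (by nlinarith)
        calc C₁ * T ^ (-(d / 2)) = C₁ * T ^ (-(d / 2)) * 1 := by ring
          _ ≤ C₁ * T ^ (-(d / 2)) * (Real.exp (c * X₀) * Real.exp (-(c * X))) := by gcongr
          _ = C₁ * Real.exp (c * X₀) * T ^ (-(d / 2)) * Real.exp (-(c * X)) := by ring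
          _ ≤ _ := by gcongr
      rcases le_or_gt (a * T / 2) R with hbig | hsmall
      · rcases Nat.eq_zero_or_pos n with rfl | hn
        · exact ih R T hT (by simpa using hbig) hR'
        · refine ih R T hT (le_trans ?_ hbig) hR'
          exact mul_le_of_le_one_right (by positivity)
            (pow_le_one₀ (by norm_num) (by norm_num))
      have hih := ih (0.8 * R) (T / 2) (by positivity)
        (by rw [pow_succ] at hR; nlinarith) (by nlinarith)
      -- The slope is proportional to R/T, as in the Gaussian optimization. Since R ≤ aT and ε ≤ 1,
      -- the factor e^(sA) stays below the constant e^(aA).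
      have hs0 : 0 ≤ ε * R / T := by positivity
      have hstep := J₃ R (0.8 * R) T (T / 2) (ε * R / T) (by linarith) (by positivity)
        (by linarith) hs0
      have hhalf : (T / 2) ^ (-(d / 2)) = θ * T ^ (-(d / 2)) := by
        rw [Real.div_rpow hT.le (by norm_num), hθ, Real.rpow_neg (by norm_num : (0:ℝ) ≤ 2)]
        field_simp
      have hXn : (0.8 * R) ^ 2 / (T / 2) = 1.28 * X := by rw [hX]; field_simp; norm_num
      rw [hhalf, hXn] at hih
      rw [hhalf] at hstep
      have hsa : ε * R / T * A ≤ a * A := by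
        gcongr
        rw [div_le_iff₀ hT]
        nlinarith
      have hexpo : -(2 * (ε * R / T) * (R - 0.8 * R)) +
          2 * (K * (ε * R / T) ^ 2 * Real.exp (ε * R / T * A)) * (T - T / 2) ≤ -(c * X) := by
        have h1 : K * (ε * R / T) ^ 2 * Real.exp (ε * R / T * A) * T ≤ 1 / 5 * ε * X := by
          calc K * (ε * R / T) ^ 2 * Real.exp (ε * R / T * A) * T
              ≤ K * (ε * R / T) ^ 2 * Real.exp (a * A) * T := by gcongr
            _ = (K' * ε) * ε * X := by rw [hK', hX]; field_simp
            _ ≤ 1 / 5 * ε * X := by gcongr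
        have h2 : 2 * (ε * R / T) * (R - 0.8 * R) = 0.4 * ε * X := by
          rw [hX]; field_simp; norm_num
        have h3 : c * X ≤ ε / 5 * X := by gcongr
        rw [h2]
        linarith
      have hgain : 2 * θ * Real.exp (-(c * (1.28 * X))) ≤ 1 / 2 * Real.exp (-(c * X)) := by
        have h1 : Real.exp (-(c * (1.28 * X))) =
            Real.exp (-(0.28 * c * X)) * Real.exp (-(c * X)) := by
          rw [← Real.exp_add]; congr 1; ring
        have h2 : Real.exp (-(0.28 * c * X)) ≤ Real.exp (-(0.28 * c * X₀)) := by
          gcongr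
        rw [h1, ← mul_assoc]
        gcongr
        calc 2 * θ * Real.exp (-(0.28 * c * X)) ≤ 2 * θ * Real.exp (-(0.28 * c * X₀)) := by gcongr
          _ = 1 / 2 := hX₀c
      calc J R T ≤ _ := hstep
        _ ≤ 2 * (B * (θ * T ^ (-(d / 2))) * Real.exp (-(c * (1.28 * X)))) +
            2 * (Real.exp (-(c * X)) * (C₁ * (θ * T ^ (-(d / 2))))) := by gcongr
        _ = B * T ^ (-(d / 2)) * (2 * θ * Real.exp (-(c * (1.28 * X)))) +
            (4 * θ * C₁) / 2 * T ^ (-(d / 2)) * Real.exp (-(c * X)) := by ring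
        _ ≤ B * T ^ (-(d / 2)) * (1 / 2 * Real.exp (-(c * X))) +
            B / 2 * T ^ (-(d / 2)) * Real.exp (-(c * X)) := by gcongr
        _ = _ := by ring
  intro R T hT hR hRT
  rcases hR.eq_or_lt with rfl | hR0
  · refine (J₁ 0 T hT).trans ?_
    have : C₁ ≤ B := by nlinarith
    simp only [ne_eq, OfNat.ofNat_ne_zero, not_false_eq_true, zero_pow, zero_div, mul_zero,
      neg_zero, Real.exp_zero, mul_one]
    gcongr
  · obtain ⟨n, hn⟩ := exists_pow_lt_of_lt_one (show 0 < R / (a * T / 2) by positivity)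
      (show (5 / 8 : ℝ) < 1 by norm_num)
    refine main n R T hT ?_ hRT
    rw [lt_div_iff₀ (by positivity)] at hn
    linarith

/-! ### Gaussian bounds for finite chains -/

namespace FiniteChain

variable {ι : Type u} {m k : ι → ℝ} {w : ι → ι → ℝ}

open Classical in
/-- The density of the unit mass at `x`. -/
noncomputable def dirac (m : ι → ℝ) (x : ι) : ι → ℝ := Pi.single x (m x)⁻¹

lemma dirac_self (x : ι) : dirac m x x = (m x)⁻¹ := by simp [dirac]

lemma dirac_of_ne {x y : ι} (hxy : y ≠ x) : dirac m x y = 0 := by simp [dirac, hxy]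

/-- A weighted arithmetic–geometric inequality. The free parameter e lets a small tail of f
compensate for a g that is only bounded in L². -/
lemma sum_mul_mul_le_add (hm : ∀ x, 0 < m x) (S : Finset ι) (f g : ι → ℝ) {e : ℝ} (he : 0 < e) :
    ∑ z ∈ S, m z * (f z * g z) ≤
      (∑ z ∈ S, m z * f z ^ 2) / e + e * ∑ z ∈ S, m z * g z ^ 2 := by
  rw [Finset.sum_div, Finset.mul_sum, ← Finset.sum_add_distrib]
  refine Finset.sum_le_sum fun z _ => ?_
  have h1 : f z * g z ≤ f z ^ 2 / e + e * g z ^ 2 := by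
    rw [← sub_nonneg]
    have : f z ^ 2 / e + e * g z ^ 2 - f z * g z
        = ((f z - e * g z / 2) ^ 2 + 3 / 4 * (e * g z) ^ 2) / e := by
      field_simp
      ring
    rw [this]
    positivity
  calc m z * (f z * g z) ≤ m z * (f z ^ 2 / e + e * g z ^ 2) :=
        mul_le_mul_of_nonneg_left h1 (hm z).le
    _ = _ := by ring

variable [Fintype ι]

/-- Chebyshev's inequality for the weight e^(2sρ): it is at least e^(2sR) on the tail and at most
e^(2sR') on the support of f. -/
lemma IsChain.tail_bound_of_support (h : IsChain m k w) {ρ : ι → ℝ} {s κ : ℝ} (hs : 0 ≤ s)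
    (hρ : ∀ x, ∑ y, w x y * Real.cosh (s * (ρ x - ρ y)) ≤ k x + κ * m x)
    {t : ℝ} (ht : 0 ≤ t) {f : ι → ℝ} {R R' : ℝ} (hf : ∀ x, R' < ρ x → f x = 0) :
    ∑ x with R ≤ ρ x, m x * semigroup m k w t f x ^ 2 ≤
      Real.exp (-(2 * s * (R - R')) + 2 * κ * t) * ∑ x, m x * f x ^ 2 := by
  have h1 : Real.exp (2 * s * R) * ∑ x with R ≤ ρ x, m x * semigroup m k w t f x ^ 2
      ≤ ∑ x, m x * (Real.exp (2 * s * ρ x) * semigroup m k w t f x ^ 2) := by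
    rw [Finset.mul_sum]
    refine (Finset.sum_le_sum fun x hx => ?_).trans (Finset.sum_le_sum_of_subset_of_nonneg
      (Finset.subset_univ _) fun x _ _ =>
        mul_nonneg (h.pos x).le (mul_nonneg (Real.exp_pos _).le (sq_nonneg _)))
    have hx' : R ≤ ρ x := (Finset.mem_filter.1 hx).2
    have := (h.pos x).le
    calc Real.exp (2 * s * R) * (m x * semigroup m k w t f x ^ 2)
        ≤ Real.exp (2 * s * ρ x) * (m x * semigroup m k w t f x ^ 2) := by gcongr
      _ = _ := by ring
  have h2 : ∑ x, m x * (Real.exp (2 * s * ρ x) * f x ^ 2)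
      ≤ Real.exp (2 * s * R') * ∑ x, m x * f x ^ 2 := by
    rw [Finset.mul_sum]
    refine Finset.sum_le_sum fun x _ => ?_
    have := (h.pos x).le
    rcases lt_or_ge R' (ρ x) with hx | hx
    · simp [hf x hx]
    · calc m x * (Real.exp (2 * s * ρ x) * f x ^ 2)
          ≤ m x * (Real.exp (2 * s * R') * f x ^ 2) := by gcongr
        _ = _ := by ring
  have h3 := h1.trans ((h.weighted_bound hρ ht f).trans
    (mul_le_mul_of_nonneg_left h2 (Real.exp_pos _).le))
  rw [← le_div_iff₀' (Real.exp_pos _)] at h3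
  refine h3.trans (le_of_eq ?_)
  have e : Real.exp (-(2 * s * (R - R')) + 2 * κ * t)
      = Real.exp (2 * κ * t) * Real.exp (2 * s * R') / Real.exp (2 * s * R) := by
    rw [← Real.exp_add, ← Real.exp_sub]
    congr 1
    ring
  rw [e]
  ring

/-- Cut f at level R'. The far part is controlled by L² contraction, the near part by Davies' bound
over the gap R - R'. This is the recursive estimate behind the Gaussian tail. -/
lemma IsChain.tail_split (h : IsChain m k w) {ρ : ι → ℝ} {s κ : ℝ} (hs : 0 ≤ s)
    (hρ : ∀ x, ∑ y, w x y * Real.cosh (s * (ρ x - ρ y)) ≤ k x + κ * m x)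
    {t : ℝ} (ht : 0 ≤ t) (f : ι → ℝ) (R R' : ℝ) :
    ∑ x with R ≤ ρ x, m x * semigroup m k w t f x ^ 2 ≤
      2 * ∑ x with R' ≤ ρ x, m x * f x ^ 2 +
      2 * (Real.exp (-(2 * s * (R - R')) + 2 * κ * t) * ∑ x, m x * f x ^ 2) := by
  set f₁ : ι → ℝ := fun x => if R' ≤ ρ x then 0 else f x with hf₁
  set f₂ : ι → ℝ := fun x => if R' ≤ ρ x then f x else 0 with hf₂
  have hsum : f = f₁ + f₂ := by
    ext x
    simp only [hf₁, hf₂, Pi.add_apply]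
    split_ifs <;> simp
  have h1 := h.tail_bound_of_support hs hρ ht (f := f₁) (R := R) (R' := R')
    (fun x hx => by simp [hf₁, hx.le])
  have h1' : ∑ x, m x * f₁ x ^ 2 ≤ ∑ x, m x * f x ^ 2 := by
    refine Finset.sum_le_sum fun x _ => ?_
    have := (h.pos x).le
    simp only [hf₁]
    split_ifs
    · simpa using mul_nonneg this (sq_nonneg (f x))
    · exact le_rfl
  have h2 : ∑ x with R ≤ ρ x, m x * semigroup m k w t f₂ x ^ 2
      ≤ ∑ x with R' ≤ ρ x, m x * f x ^ 2 := by
    refine (Finset.sum_le_sum_of_subset_of_nonneg (Finset.subset_univ _) fun x _ _ =>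
      mul_nonneg (h.pos x).le (sq_nonneg _)).trans ((h.sum_sq_semigroup_le ht f₂).trans
        (le_of_eq ?_))
    rw [Finset.sum_filter]
    refine Finset.sum_congr rfl fun x _ => ?_
    simp only [hf₂]
    split_ifs <;> simp
  have h3 : ∑ x with R ≤ ρ x, m x * semigroup m k w t f x ^ 2
      ≤ 2 * ∑ x with R ≤ ρ x, m x * semigroup m k w t f₂ x ^ 2 +
        2 * ∑ x with R ≤ ρ x, m x * semigroup m k w t f₁ x ^ 2 := by
    rw [Finset.mul_sum, Finset.mul_sum, ← Finset.sum_add_distrib]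
    refine Finset.sum_le_sum fun x _ => ?_
    have e : semigroup m k w t f x = semigroup m k w t f₁ x + semigroup m k w t f₂ x := by
      conv_lhs => rw [hsum, map_add]
      rfl
    rw [e]
    nlinarith [mul_nonneg (h.pos x).le
      (sq_nonneg (semigroup m k w t f₁ x - semigroup m k w t f₂ x))]
  have h4 := h1.trans (mul_le_mul_of_nonneg_left h1' (Real.exp_pos _).le)
  linarith

lemma IsChain.dirac_nonneg (h : IsChain m k w) (x y : ι) : 0 ≤ dirac m x y := by
  by_cases hxy : y = x
  · subst hxy; rw [dirac_self]; exact (inv_pos.2 (h.pos _)).le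
  · rw [dirac_of_ne hxy]

lemma IsChain.sum_dirac_mul (h : IsChain m k w) (x : ι) (f : ι → ℝ) :
    ∑ y, m y * (dirac m x y * f y) = f x := by
  rw [Finset.sum_eq_single x (fun y _ hy => by simp [dirac_of_ne hy]) (by simp), dirac_self,
    ← mul_assoc, mul_inv_cancel₀ (h.pos x).ne', one_mul]

lemma IsChain.sum_dirac_sq (h : IsChain m k w) (x : ι) :
    ∑ y, m y * dirac m x y ^ 2 = (m x)⁻¹ := by
  simp only [sq, h.sum_dirac_mul, dirac_self]

lemma IsChain.sum_dirac (h : IsChain m k w) (x : ι) : ∑ y, m y * dirac m x y = 1 := by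
  simpa using h.sum_dirac_mul x (fun _ => 1)

lemma IsChain.heatKernel_symm (h : IsChain m k w) (t : ℝ) (x y : ι) :
    semigroup m k w t (dirac m x) y = semigroup m k w t (dirac m y) x := by
  have := h.semigroup_symm t (dirac m x) (dirac m y)
  rwa [h.sum_dirac_mul, h.sum_dirac_mul] at this

lemma IsChain.heatKernel_add (h : IsChain m k w) (t : ℝ) (x y : ι) :
    semigroup m k w (t + t) (dirac m x) y =
      ∑ z, m z * (semigroup m k w t (dirac m x) z * semigroup m k w t (dirac m y) z) := by
  rw [semigroup_add_apply, ← h.sum_dirac_mul y (semigroup m k w t _), h.semigroup_symm]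

/-- Davies' bound without the volume factor. -/
lemma IsChain.heatKernel_le_exp (h : IsChain m k w) {M : ℝ} (hM : ∀ x, (m x)⁻¹ ≤ M)
    {ρ : ι → ℝ} {s κ : ℝ} (hs : 0 ≤ s)
    (hρ : ∀ x, ∑ y, w x y * Real.cosh (s * (ρ x - ρ y)) ≤ k x + κ * m x)
    {t : ℝ} (ht : 0 ≤ t) {x y : ι} (hx : ρ x = 0) :
    semigroup m k w t (dirac m x) y ≤ M * Real.exp (-(s * ρ y) + κ * t) := by
  have hM0 : 0 < M := lt_of_lt_of_le (inv_pos.2 (h.pos x)) (hM x)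
  have h1 := h.tail_bound_of_support hs hρ ht (f := dirac m x) (R := ρ y) (R' := 0)
    (fun z hz => dirac_of_ne (by rintro rfl; linarith))
  rw [h.sum_dirac_sq] at h1
  have h2 : m y * semigroup m k w t (dirac m x) y ^ 2 ≤
      ∑ z with ρ y ≤ ρ z, m z * semigroup m k w t (dirac m x) z ^ 2 :=
    Finset.single_le_sum (f := fun z => m z * semigroup m k w t (dirac m x) z ^ 2)
      (fun z _ => mul_nonneg (h.pos z).le (sq_nonneg _)) (by simp)
  have h3 : semigroup m k w t (dirac m x) y ^ 2 ≤
      M * (Real.exp (-(2 * s * (ρ y - 0)) + 2 * κ * t) * M) := by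
    have h4 := h2.trans (h1.trans (mul_le_mul_of_nonneg_left (hM x) (Real.exp_pos _).le))
    calc semigroup m k w t (dirac m x) y ^ 2
        = (m y)⁻¹ * (m y * semigroup m k w t (dirac m x) y ^ 2) := by
          rw [inv_mul_cancel_left₀ (h.pos y).ne']
      _ ≤ (m y)⁻¹ * (Real.exp (-(2 * s * (ρ y - 0)) + 2 * κ * t) * M) :=
          mul_le_mul_of_nonneg_left h4 (inv_pos.2 (h.pos y)).le
      _ ≤ _ := mul_le_mul_of_nonneg_right (hM y) (by positivity)
  refine abs_le_of_sq_le_sq' (h3.trans (le_of_eq ?_)) (by positivity) |>.2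
  rw [mul_pow, ← Real.exp_nat_mul]
  have e : ((2 : ℕ) : ℝ) * (-(s * ρ y) + κ * t) = -(2 * s * (ρ y - 0)) + 2 * κ * t := by
    push_cast
    ring
  rw [e]
  ring

/-- The Nash inequality for a finite chain, for functions of `L¹` norm at most one. -/
def IsNash (m k : ι → ℝ) (w : ι → ι → ℝ) (d C : ℝ) : Prop :=
  ∀ f : ι → ℝ, ∑ x, m x * |f x| ≤ 1 → C * (∑ x, m x * f x ^ 2) ^ (1 + 2 / d) ≤
    ∑ x, k x * (f x * f x) - ∑ x, ∑ y, w x y * (f x * f y)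

lemma IsChain.sum_sq_heatKernel_le (h : IsChain m k w) {d C : ℝ} (hd : 1 ≤ d) (hC : 0 < C)
    (nash : IsNash m k w d C) {t : ℝ} (ht : 0 < t) (x : ι) :
    ∑ z, m z * semigroup m k w t (dirac m x) z ^ 2 ≤
      (4 * C / d) ^ (-(d / 2)) * t ^ (-(d / 2)) :=
  h.nash_bound hd hC nash (h.dirac_nonneg x) (h.sum_dirac x).le ht

lemma IsChain.heatKernel_diag_le (h : IsChain m k w) {d C : ℝ} (hd : 1 ≤ d) (hC : 0 < C)
    (nash : IsNash m k w d C) {t : ℝ} (ht : 0 < t) (x y : ι) :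
    semigroup m k w (t + t) (dirac m x) y ≤
      2 * ((4 * C / d) ^ (-(d / 2)) * t ^ (-(d / 2))) := by
  rw [h.heatKernel_add]
  have h1 := sum_mul_mul_le_add h.pos Finset.univ (semigroup m k w t (dirac m x))
    (semigroup m k w t (dirac m y)) one_pos
  have h2 := h.sum_sq_heatKernel_le hd hC nash ht x
  have h3 := h.sum_sq_heatKernel_le hd hC nash ht y
  linarith

/-- The off-diagonal Gaussian bound, with constants independent of the chain. -/
theorem exists_gaussian_bound {K A C M d a : ℝ} (hK : 0 < K) (hA : 0 < A) (hC : 0 < C)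
    (hM : 0 < M) (hd : 1 ≤ d) (ha : 0 < a) :
    ∃ B c : ℝ, 0 < B ∧ 0 < c ∧ ∀ (ι : Type u) [Fintype ι] (m k : ι → ℝ) (w : ι → ι → ℝ),
      IsChain m k w → (∀ x, (m x)⁻¹ ≤ M) → IsNash m k w d C →
      ∀ (x y : ι) (ρ ρ' : ι → ℝ), ρ x = 0 → ρ' y = 0 →
      (∀ s, 0 ≤ s → ∀ x, ∑ y, w x y * Real.cosh (s * (ρ x - ρ y)) ≤
        k x + K * s ^ 2 * Real.exp (s * A) * m x) →
      (∀ s, 0 ≤ s → ∀ x, ∑ y, w x y * Real.cosh (s * (ρ' x - ρ' y)) ≤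
        k x + K * s ^ 2 * Real.exp (s * A) * m x) →
      ∀ R T, 0 < T → 0 ≤ R → R ≤ a * T → (∀ z, 2 * R ≤ ρ z + ρ' z) →
        semigroup m k w (T + T) (dirac m x) y ≤
          B * T ^ (-(d / 2)) * Real.exp (-(c * (R ^ 2 / T))) := by
  set C₁ : ℝ := (4 * C / d) ^ (-(d / 2)) with hC₁
  have hC₁0 : 0 < C₁ := by positivity
  obtain ⟨B, c, hB, hc, H⟩ := exists_gaussian_tail hK hA hC₁0 hM (by linarith : 0 < d) ha
  refine ⟨2 * (B + C₁), c / 2, by positivity, by positivity, ?_⟩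
  intro ι _ m k w h hm nash x y ρ ρ' hx hy hρ hρ' R T hT hR hRT hz
  have tail : ∀ (x : ι) (ρ : ι → ℝ), ρ x = 0 →
      (∀ s, 0 ≤ s → ∀ x, ∑ y, w x y * Real.cosh (s * (ρ x - ρ y)) ≤
        k x + K * s ^ 2 * Real.exp (s * A) * m x) →
      ∑ z with R ≤ ρ z, m z * semigroup m k w T (dirac m x) z ^ 2 ≤
        B * T ^ (-(d / 2)) * Real.exp (-(c * (R ^ 2 / T))) := by
    intro x ρ hx hρ
    refine H (fun R T => ∑ z with R ≤ ρ z, m z * semigroup m k w T (dirac m x) z ^ 2)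
      (fun R T hT => ?_) (fun R T s hT hs => ?_) (fun R R' T T' s hR hT' hT hs => ?_)
      R T hT hR hRT
    · exact (Finset.sum_le_sum_of_subset_of_nonneg (Finset.subset_univ _) fun x _ _ =>
        mul_nonneg (h.pos x).le (sq_nonneg _)).trans (h.sum_sq_heatKernel_le hd hC nash hT x)
    · have h1 := h.tail_bound_of_support hs (hρ s hs) hT.le (f := dirac m x) (R := R) (R' := 0)
        (fun z hz => dirac_of_ne (by rintro rfl; linarith))
      rw [h.sum_dirac_sq, sub_zero, mul_comm] at h1
      exact h1.trans (mul_le_mul_of_nonneg_right (hm x) (Real.exp_pos _).le)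
    · have h1 := h.tail_split hs (hρ s hs) (sub_nonneg.2 hT.le)
        (semigroup m k w T' (dirac m x)) R R'
      rw [← semigroup_add_apply, sub_add_cancel] at h1
      refine h1.trans ?_
      gcongr
      exact h.sum_sq_heatKernel_le hd hC nash hT' x
  set X : ℝ := R ^ 2 / T
  -- The square root of the tail's Gaussian factor balances tail/e against e times the on-diagonal
  -- bound; hence the rate c/2.
  set e : ℝ := Real.exp (-(c / 2 * X)) with he
  have he0 : 0 < e := Real.exp_pos _
  have hee : Real.exp (-(c * X)) = e * e := by
    rw [he, ← Real.exp_add]; congr 1; ring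
  have hT0 : 0 < T ^ (-(d / 2)) := Real.rpow_pos_of_pos hT _
  have half : ∀ (x y : ι) (ρ : ι → ℝ), ρ x = 0 →
      (∀ s, 0 ≤ s → ∀ x, ∑ y, w x y * Real.cosh (s * (ρ x - ρ y)) ≤
        k x + K * s ^ 2 * Real.exp (s * A) * m x) →
      ∑ z with R ≤ ρ z, m z * (semigroup m k w T (dirac m x) z * semigroup m k w T (dirac m y) z)
        ≤ (B + C₁) * T ^ (-(d / 2)) * e := by
    intro x y ρ hx hρ
    refine (sum_mul_mul_le_add h.pos _ _ _ he0).trans ?_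
    have h1 := tail x ρ hx hρ
    have h2 : ∑ z with R ≤ ρ z, m z * semigroup m k w T (dirac m y) z ^ 2
        ≤ C₁ * T ^ (-(d / 2)) :=
      (Finset.sum_le_sum_of_subset_of_nonneg (Finset.subset_univ _) fun x _ _ =>
        mul_nonneg (h.pos x).le (sq_nonneg _)).trans (h.sum_sq_heatKernel_le hd hC nash hT y)
    rw [hee] at h1
    calc _ ≤ B * T ^ (-(d / 2)) * (e * e) / e + e * (C₁ * T ^ (-(d / 2))) := by gcongr
      _ = _ := by field_simp
  have hkey : semigroup m k w (T + T) (dirac m x) y ≤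
      ∑ z with R ≤ ρ z, m z * (semigroup m k w T (dirac m x) z * semigroup m k w T (dirac m y) z)
      + ∑ z with R ≤ ρ' z,
        m z * (semigroup m k w T (dirac m y) z * semigroup m k w T (dirac m x) z) := by
    -- Since ρ + ρ' ≥ 2R, every z lies in at least one of the two far sets; counting some z twice is
    -- harmless because the terms are nonnegative.
    rw [h.heatKernel_add, Finset.sum_filter, Finset.sum_filter, ← Finset.sum_add_distrib]
    refine Finset.sum_le_sum fun z _ => ?_
    have h1 : 0 ≤ m z * (semigroup m k w T (dirac m x) z * semigroup m k w T (dirac m y) z) :=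
      mul_nonneg (h.pos z).le (mul_nonneg (h.semigroup_nonneg hT.le (h.dirac_nonneg x) z)
        (h.semigroup_nonneg hT.le (h.dirac_nonneg y) z))
    rw [mul_comm (semigroup m k w T (dirac m y) z)]
    have := hz z
    split_ifs <;> linarith
  have h1 := half x y ρ hx hρ
  have h2 := half y x ρ' hy hρ'
  linarith

end FiniteChain

/-! ### The chain on the graph, killed outside a finite set -/

lemma FiniteChain.IsChain.form_nonneg {ι : Type u} [Fintype ι] {m k : ι → ℝ} {w : ι → ι → ℝ}
    (h : FiniteChain.IsChain m k w) (f : ι → ℝ) :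
    0 ≤ ∑ x, k x * (f x * f x) - ∑ x, ∑ y, w x y * (f x * f y) := by
  have e1 : ∑ x, ∑ y, w x y * f y ^ 2 = ∑ x, ∑ y, w x y * f x ^ 2 := by
    rw [Finset.sum_comm]
    exact Finset.sum_congr rfl fun x _ => Finset.sum_congr rfl fun y _ => by rw [h.symm]
  have e2 : 2 * ∑ x, ∑ y, w x y * (f x * f y) ≤
      ∑ x, ∑ y, w x y * f x ^ 2 + ∑ x, ∑ y, w x y * f y ^ 2 := by
    simp only [Finset.mul_sum, ← Finset.sum_add_distrib]
    refine Finset.sum_le_sum fun x _ => Finset.sum_le_sum fun y _ => ?_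
    nlinarith [mul_nonneg (h.nonneg x y) (sq_nonneg (f x - f y))]
  have e3 : ∑ x, ∑ y, w x y * f x ^ 2 ≤ ∑ x, k x * (f x * f x) := by
    refine Finset.sum_le_sum fun x _ => ?_
    rw [← Finset.sum_mul, ← sq]
    exact mul_le_mul_of_nonneg_right (h.sum_le x) (sq_nonneg _)
  linarith

namespace WeightedGraph

variable {V : Type u} {Γ : SimpleGraph V} {μ : Sym2 V → ℝ}

lemma edgeWeight_of_adj {x y : V} (h : Γ.Adj x y) : edgeWeight Γ μ x y = μ s(x, y) :=
  indicator_of_mem (Γ.mem_edgeSet.2 h) _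

lemma edgeWeight_of_not_adj {x y : V} (h : ¬ Γ.Adj x y) : edgeWeight Γ μ x y = 0 :=
  indicator_of_notMem (fun h' => h (Γ.mem_edgeSet.1 h')) _

lemma edgeWeight_comm (x y : V) : edgeWeight Γ μ x y = edgeWeight Γ μ y x := by
  rw [edgeWeight, edgeWeight, Sym2.eq_swap]

lemma vertexWeight_eq_sum {x : V} {S : Finset V}
    (hS : ∀ y, Γ.Adj x y → y ∈ S) : vertexWeight Γ μ x = ∑ y ∈ S, edgeWeight Γ μ x y :=
  tsum_eq_sum fun y hy => edgeWeight_of_not_adj fun h' => hy (hS y h')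

variable [MeasurableSpace V] {ν : Measure V} {CD : ℕ} {CM : ℝ}

namespace IsAdmissible

lemma edgeWeight_nonneg (h : IsAdmissible Γ μ ν CD CM) (x y : V) : 0 ≤ edgeWeight Γ μ x y :=
  indicator_nonneg (fun e he => (h.weight_pos e he).le) _

lemma finite_neighborSet (h : IsAdmissible Γ μ ν CD CM) (x : V) : (Γ.neighborSet x).Finite :=
  Set.finite_of_encard_le_coe (h.degree_le x)

/-- The finite set of neighbours of a vertex. -/
noncomputable def neighbors (h : IsAdmissible Γ μ ν CD CM) (x : V) : Finset V :=
  (h.finite_neighborSet x).toFinset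

lemma mem_neighbors (h : IsAdmissible Γ μ ν CD CM) {x y : V} :
    y ∈ h.neighbors x ↔ Γ.Adj x y := by
  simp [neighbors]

lemma card_neighbors_le (h : IsAdmissible Γ μ ν CD CM) (x : V) : (h.neighbors x).card ≤ CD := by
  have := h.degree_le x
  rw [(h.finite_neighborSet x).encard_eq_coe_toFinset_card] at this
  exact_mod_cast this

lemma sum_le_vertexWeight (h : IsAdmissible Γ μ ν CD CM) (x : V) (S : Finset V) :
    ∑ y ∈ S, edgeWeight Γ μ x y ≤ vertexWeight Γ μ x := by
  classical
  rw [vertexWeight_eq_sum (S := S ∪ h.neighbors x)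
    fun y hy => Finset.mem_union_right _ (h.mem_neighbors.2 hy)]
  exact Finset.sum_le_sum_of_subset_of_nonneg Finset.subset_union_left
    fun y _ _ => h.edgeWeight_nonneg x y

lemma vertexWeight_pos (h : IsAdmissible Γ μ ν CD CM) [Nontrivial V] (x : V) :
    0 < vertexWeight Γ μ x := by
  obtain ⟨y, hy⟩ := h.connected.preconnected.exists_adj_of_nontrivial x
  refine lt_of_lt_of_le ?_ (h.sum_le_vertexWeight x {y})
  rw [Finset.sum_singleton, edgeWeight_of_adj hy]
  exact h.weight_pos _ (Γ.mem_edgeSet.2 hy)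

lemma measure_ne_top (h : IsAdmissible Γ μ ν CD CM) (x : V) : ν {x} ≠ ⊤ :=
  ((h.measure_le x).trans_lt ENNReal.ofReal_lt_top).ne

lemma ofReal_real (h : IsAdmissible Γ μ ν CD CM) (x : V) :
    ENNReal.ofReal (ν.real {x}) = ν {x} := ENNReal.ofReal_toReal (h.measure_ne_top x)

lemma inv_le_real (h : IsAdmissible Γ μ ν CD CM) (x : V) : CM⁻¹ ≤ ν.real {x} :=
  (ENNReal.ofReal_le_iff_le_toReal (h.measure_ne_top x)).1 (h.le_measure x)

lemma real_pos (h : IsAdmissible Γ μ ν CD CM) (hCM : 0 < CM) (x : V) : 0 < ν.real {x} :=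
  (inv_pos.2 hCM).trans_le (h.inv_le_real x)

lemma inv_real_le (h : IsAdmissible Γ μ ν CD CM) (hCM : 0 < CM) (x : V) :
    (ν.real {x})⁻¹ ≤ CM :=
  inv_le_of_inv_le₀ hCM (h.inv_le_real x)

end IsAdmissible

open FiniteChain

/-- The reference measure on a finite set of vertices. -/
noncomputable def restrictMeasure (ν : Measure V) (A : Finset V) (x : A) : ℝ := ν.real {(x : V)}

/-- The total weights on a finite set of vertices. -/
noncomputable def restrictTotal (Γ : SimpleGraph V) (μ : Sym2 V → ℝ) (A : Finset V) (x : A) : ℝ :=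
  vertexWeight Γ μ x

/-- The conductances on a finite set of vertices. -/
noncomputable def restrictWeight (Γ : SimpleGraph V) (μ : Sym2 V → ℝ) (A : Finset V) (x y : A) : ℝ :=
  edgeWeight Γ μ x y

/-- The total weight at x is taken in the whole graph, so jumps out of A become killing and the row
sums satisfy only an inequality. -/
lemma IsAdmissible.isChain (h : IsAdmissible Γ μ ν CD CM) (hCM : 0 < CM) (A : Finset V) :
    IsChain (restrictMeasure ν A) (restrictTotal Γ μ A) (restrictWeight Γ μ A) where
  pos x := h.real_pos hCM x
  nonneg x y := h.edgeWeight_nonneg x y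
  symm x y := edgeWeight_comm _ _
  sum_le x := by
    have := h.sum_le_vertexWeight x A
    rwa [← Finset.sum_coe_sort] at this

lemma lintegral_eq_sum_of_support [MeasurableSingletonClass V] (A : Finset V) {g : V → ℝ≥0∞}
    (hg : ∀ x, x ∉ A → g x = 0) : ∫⁻ x, g x ∂ν = ∑ x ∈ A, g x * ν {x} := by
  rw [← lintegral_finset, ← lintegral_indicator A.measurableSet]
  refine lintegral_congr fun x => ?_
  by_cases hx : x ∈ A
  · simp [hx]
  · simp [hx, hg x hx]

lemma IsAdmissible.eLpNorm_one_eq [MeasurableSingletonClass V] (h : IsAdmissible Γ μ ν CD CM)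
    {A : Finset V} {F : V → ℝ} (hF : ∀ x, x ∉ A → F x = 0) :
    eLpNorm F 1 ν = ENNReal.ofReal (∑ x ∈ A, ν.real {x} * |F x|) := by
  rw [eLpNorm_one_eq_lintegral_enorm, lintegral_eq_sum_of_support A fun x hx => by simp [hF x hx],
    ENNReal.ofReal_sum_of_nonneg fun x _ => mul_nonneg measureReal_nonneg (abs_nonneg _)]
  refine Finset.sum_congr rfl fun x _ => ?_
  rw [ENNReal.ofReal_mul measureReal_nonneg, h.ofReal_real, mul_comm, Real.enorm_eq_ofReal_abs]

lemma IsAdmissible.eLpNorm_two_eq [MeasurableSingletonClass V] (h : IsAdmissible Γ μ ν CD CM)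
    {A : Finset V} {F : V → ℝ} (hF : ∀ x, x ∉ A → F x = 0) :
    eLpNorm F 2 ν = ENNReal.ofReal (∑ x ∈ A, ν.real {x} * F x ^ 2) ^ (1 / 2 : ℝ) := by
  rw [eLpNorm_eq_lintegral_rpow_enorm_toReal two_ne_zero ENNReal.ofNat_ne_top]
  simp only [ENNReal.toReal_ofNat, ENNReal.rpow_ofNat]
  congr 1
  rw [lintegral_eq_sum_of_support A fun x hx => by simp [hF x hx],
    ENNReal.ofReal_sum_of_nonneg fun x _ => mul_nonneg measureReal_nonneg (sq_nonneg _)]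
  refine Finset.sum_congr rfl fun x _ => ?_
  rw [ENNReal.ofReal_mul measureReal_nonneg, h.ofReal_real, mul_comm, Real.enorm_eq_ofReal_abs,
    ← ENNReal.ofReal_pow (abs_nonneg _), sq_abs]

/-- An edge from x in A to a vertex outside contributes μ_{xy} F(x)², which is exactly the killing
term of the chain on A. Enlarging A by its neighbours captures every contributing edge. -/
lemma IsAdmissible.energy_eq (h : IsAdmissible Γ μ ν CD CM) {A : Finset V} {F : V → ℝ}
    (hF : ∀ x, x ∉ A → F x = 0) :
    energy Γ μ F = ENNReal.ofReal (∑ x ∈ A, vertexWeight Γ μ x * (F x * F x) -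
      ∑ x ∈ A, ∑ y ∈ A, edgeWeight Γ μ x y * (F x * F y)) := by
  classical
  set B : Finset V := A ∪ A.biUnion h.neighbors with hB
  have hAB : A ⊆ B := Finset.subset_union_left
  have hnB : ∀ x ∈ A, ∀ y, Γ.Adj x y → y ∈ B := fun x hx y hy =>
    Finset.mem_union_right _ (Finset.mem_biUnion.2 ⟨x, hx, h.mem_neighbors.2 hy⟩)
  have hzero : ∀ x y, x ∉ B → edgeWeight Γ μ x y * (F y - F x) ^ 2 = 0 := by
    intro x y hx
    have hxA : x ∉ A := fun h' => hx (hAB h')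
    by_cases hy : y ∈ A
    · rw [edgeWeight_of_not_adj fun h' => hx (hnB y hy x h'.symm), zero_mul]
    · rw [hF x hxA, hF y hy]; ring
  have hzero' : ∀ x y, y ∉ B → edgeWeight Γ μ x y * (F y - F x) ^ 2 = 0 := by
    intro x y hy
    rw [edgeWeight_comm, ← hzero y x hy]; ring
  have hterm : ∀ x y, 0 ≤ edgeWeight Γ μ x y * (F y - F x) ^ 2 := fun x y =>
    mul_nonneg (h.edgeWeight_nonneg x y) (sq_nonneg _)
  have e1 : energy Γ μ F =
      2⁻¹ * ENNReal.ofReal (∑ x ∈ B, ∑ y ∈ B, edgeWeight Γ μ x y * (F y - F x) ^ 2) := by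
    rw [energy, tsum_eq_sum (s := B) fun x hx => by simp [hzero x _ hx],
      ENNReal.ofReal_sum_of_nonneg fun x _ => Finset.sum_nonneg fun y _ => hterm x y]
    congr 1
    refine Finset.sum_congr rfl fun x _ => ?_
    rw [tsum_eq_sum (s := B) fun y hy => by simp [hzero' x y hy],
      ENNReal.ofReal_sum_of_nonneg fun y _ => hterm x y]
  have e2 : ∑ x ∈ A, vertexWeight Γ μ x * (F x * F x)
      = ∑ x ∈ B, ∑ y ∈ B, edgeWeight Γ μ x y * F x ^ 2 := by
    rw [← Finset.sum_subset hAB fun x _ hx => by simp [hF x hx]]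
    refine Finset.sum_congr rfl fun x hx => ?_
    rw [vertexWeight_eq_sum (hnB x hx), Finset.sum_mul]
    exact Finset.sum_congr rfl fun y _ => by ring
  have e3 : ∑ x ∈ A, ∑ y ∈ A, edgeWeight Γ μ x y * (F x * F y)
      = ∑ x ∈ B, ∑ y ∈ B, edgeWeight Γ μ x y * (F x * F y) := by
    rw [← Finset.sum_subset hAB fun x _ hx => by simp [hF x hx]]
    refine Finset.sum_congr rfl fun x _ => ?_
    rw [← Finset.sum_subset hAB fun y _ hy => by simp [hF y hy]]
  have e4 : ∑ x ∈ B, ∑ y ∈ B, edgeWeight Γ μ x y * F y ^ 2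
      = ∑ x ∈ B, ∑ y ∈ B, edgeWeight Γ μ x y * F x ^ 2 := by
    rw [Finset.sum_comm]
    exact Finset.sum_congr rfl fun x _ => Finset.sum_congr rfl fun y _ => by
      rw [edgeWeight_comm]
  have e5 : ∑ x ∈ B, ∑ y ∈ B, edgeWeight Γ μ x y * (F y - F x) ^ 2
      = 2 * (∑ x ∈ A, vertexWeight Γ μ x * (F x * F x) -
        ∑ x ∈ A, ∑ y ∈ A, edgeWeight Γ μ x y * (F x * F y)) := by
    have e6 : ∑ x ∈ B, ∑ y ∈ B, edgeWeight Γ μ x y * (F y - F x) ^ 2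
        = ∑ x ∈ B, ∑ y ∈ B, edgeWeight Γ μ x y * F y ^ 2 +
          ∑ x ∈ B, ∑ y ∈ B, edgeWeight Γ μ x y * F x ^ 2 -
          2 * ∑ x ∈ B, ∑ y ∈ B, edgeWeight Γ μ x y * (F x * F y) := by
      simp only [Finset.mul_sum, ← Finset.sum_add_distrib, ← Finset.sum_sub_distrib]
      exact Finset.sum_congr rfl fun x _ => Finset.sum_congr rfl fun y _ => by ring
    rw [e6, e4, e2, e3]
    ring
  rw [e1, e5, ENNReal.ofReal_mul two_pos.le, ENNReal.ofReal_ofNat, ← mul_assoc,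
    ENNReal.inv_mul_cancel two_ne_zero ENNReal.ofNat_ne_top, one_mul]

lemma IsAdmissible.isNash [DiscreteMeasurableSpace V] (h : IsAdmissible Γ μ ν CD CM)
    (hCM : 0 < CM) {d CV CN : ℝ} (hd : 1 ≤ d) (hCN : 0 < CN)
    (hN : WeightedGraph.IsNash Γ μ ν d CV CN) (A : Finset V) :
    FiniteChain.IsNash (restrictMeasure ν A) (restrictTotal Γ μ A) (restrictWeight Γ μ A) d CN := by
  classical
  have hd0 : 0 < d := by linarith
  intro f hf
  set F : V → ℝ := fun x => if hx : x ∈ A then f ⟨x, hx⟩ else 0 with hFdef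
  have hF : ∀ x, x ∉ A → F x = 0 := fun x hx => by simp [hFdef, hx]
  have hFf : ∀ x : A, F x = f x := fun x => by simp [hFdef]
  have hmeas : AEStronglyMeasurable F ν := Measurable.of_discrete.aestronglyMeasurable
  have s1 : ∑ x ∈ A, ν.real {x} * |F x| = ∑ x : A, restrictMeasure ν A x * |f x| := by
    rw [← Finset.sum_coe_sort]
    exact Finset.sum_congr rfl fun x _ => by rw [hFf]; rfl
  have s2 : ∑ x ∈ A, ν.real {x} * F x ^ 2 = ∑ x : A, restrictMeasure ν A x * f x ^ 2 := by
    rw [← Finset.sum_coe_sort]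
    exact Finset.sum_congr rfl fun x _ => by rw [hFf]; rfl
  have s3 : ∑ x ∈ A, vertexWeight Γ μ x * (F x * F x) -
      ∑ x ∈ A, ∑ y ∈ A, edgeWeight Γ μ x y * (F x * F y) =
      ∑ x : A, restrictTotal Γ μ A x * (f x * f x) -
        ∑ x : A, ∑ y : A, restrictWeight Γ μ A x y * (f x * f y) := by
    rw [← Finset.sum_coe_sort A fun x => vertexWeight Γ μ x * (F x * F x),
      ← Finset.sum_coe_sort A fun x => ∑ y ∈ A, edgeWeight Γ μ x y * (F x * F y)]
    congr 1
    · exact Finset.sum_congr rfl fun x _ => by rw [hFf]; rfl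
    · refine Finset.sum_congr rfl fun x _ => ?_
      rw [← Finset.sum_coe_sort]
      exact Finset.sum_congr rfl fun y _ => by rw [hFf, hFf]; rfl
  have n1 := h.eLpNorm_one_eq hF
  have n2 := h.eLpNorm_two_eq hF
  have key := hN.nash F ⟨hmeas, by rw [n1]; exact ENNReal.ofReal_lt_top⟩
    ⟨hmeas, by rw [n2]; exact ENNReal.rpow_lt_top_of_nonneg (by norm_num) ENNReal.ofReal_ne_top⟩
  rw [h.energy_eq hF, n1, n2, s1, s2, s3, ← ENNReal.rpow_mul] at key
  have hexp : (1 / 2 : ℝ) * (2 + 4 / d) = 1 + 2 / d := by ring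
  have hexp0 : 0 ≤ 1 + 2 / d := by positivity
  have hsq : 0 ≤ ∑ x : A, restrictMeasure ν A x * f x ^ 2 :=
    Finset.sum_nonneg fun x _ => mul_nonneg measureReal_nonneg (sq_nonneg _)
  rw [hexp, ENNReal.ofReal_rpow_of_nonneg hsq hexp0] at key
  -- As ‖f‖₁ ≤ 1, the factor ‖f‖₁^(-4/d) is at least 1 (infinite for f = 0) and can be dropped.
  have hone : 1 ≤ ENNReal.ofReal (∑ x : A, restrictMeasure ν A x * |f x|) ^ (-(4 / d)) := by
    rw [ENNReal.rpow_neg]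
    refine ENNReal.one_le_inv.2 (ENNReal.rpow_le_one ?_ (by positivity))
    exact ENNReal.ofReal_le_one.2 hf
  have key2 := (le_mul_of_one_le_right' hone).trans key
  rw [← ENNReal.ofReal_mul hCN.le, ENNReal.ofReal_le_ofReal_iff] at key2
  · exact key2
  · exact (h.isChain hCM A).form_nonneg f

end WeightedGraph

/-! ### Decomposition at the first jump -/

namespace FiniteChain

variable {ι : Type u} [Fintype ι] {m k : ι → ℝ} {w : ι → ι → ℝ}

lemma continuous_semigroup_apply (f : ι → ℝ) (x : ι) :
    Continuous fun t => semigroup m k w t f x :=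
  continuous_iff_continuousAt.2 fun t => (hasDerivAt_semigroup_apply m k w f t x).continuousAt

/-- The renewal equation at the first jump, obtained by integrating the s-derivative of -e^(-(k/m)s)
P_{t-s} f(x), with P the semigroup. It matches the recursion that defines `jumpProb`. -/
lemma semigroup_eq_integral (t : ℝ) (f : ι → ℝ) (x : ι) :
    semigroup m k w t f x = Real.exp (-(k x / m x * t)) * f x +
      ∫ s in (0 : ℝ)..t, Real.exp (-(k x / m x * s)) *
        ((∑ y, w x y * semigroup m k w (t - s) f y) / m x) := by
  have hd : ∀ s, HasDerivAt
      (fun s => -(Real.exp (-(k x / m x * s)) * semigroup m k w (t - s) f x))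
      (Real.exp (-(k x / m x * s)) * ((∑ y, w x y * semigroup m k w (t - s) f y) / m x)) s := by
    intro s
    have h1 : HasDerivAt (fun s => Real.exp (-(k x / m x * s)))
        (Real.exp (-(k x / m x * s)) * (-(k x / m x * 1))) s :=
      (((hasDerivAt_id s).const_mul (k x / m x)).neg).exp
    have h2 : HasDerivAt (fun s => semigroup m k w (t - s) f x)
        (-generator m k w (semigroup m k w (t - s) f) x) s :=
      (hasDerivAt_semigroup_apply m k w f (t - s) x).comp_const_sub t s
    refine (h1.mul h2).neg.congr_deriv ?_
    rw [generator_apply]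
    ring
  have hc : Continuous fun s => Real.exp (-(k x / m x * s)) *
      ((∑ y, w x y * semigroup m k w (t - s) f y) / m x) := by
    refine Continuous.mul (by fun_prop) (Continuous.div_const ?_ _)
    exact continuous_finsetSum _ fun y _ => continuous_const.mul
      ((continuous_semigroup_apply f y).comp (continuous_const.sub continuous_id))
  rw [intervalIntegral.integral_eq_sub_of_hasDerivAt (fun s _ => hd s) (hc.intervalIntegrable _ _)]
  simp [semigroup_zero]

end FiniteChain

lemma expMeasure_Ioi {r t : ℝ} (hr : 0 < r) (ht : 0 ≤ t) :
    expMeasure r (Ioi t) = ENNReal.ofReal (Real.exp (-(r * t))) := by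
  have := isProbabilityMeasure_expMeasure hr
  have h1 : expMeasure r (Iic t) = ENNReal.ofReal (1 - Real.exp (-(r * t))) := by
    rw [← ofReal_cdf, cdf_expMeasure_eq hr, if_pos ht]
  rw [← compl_Iic, prob_compl_eq_one_sub measurableSet_Iic, h1, ← ENNReal.ofReal_one,
    ← ENNReal.ofReal_sub _ (sub_nonneg.2 (Real.exp_le_one_iff.2 (by nlinarith))), sub_sub_cancel]

lemma setLIntegral_expMeasure {r t : ℝ} (hr : 0 < r) (ht : 0 ≤ t) {φ : ℝ → ℝ}
    (hφ : Continuous φ) (hφ0 : ∀ s ∈ Icc 0 t, 0 ≤ φ s) :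
    ∫⁻ s in Iic t, ENNReal.ofReal (φ s) ∂(expMeasure r) =
      ENNReal.ofReal (∫ s in (0 : ℝ)..t, r * Real.exp (-(r * s)) * φ s) := by
  have hm : Measurable (exponentialPDF r) :=
    ENNReal.measurable_ofReal.comp (measurable_exponentialPDFReal r)
  have e1 : ∫⁻ s in Iic t, ENNReal.ofReal (φ s) ∂(expMeasure r) =
      ∫⁻ s in Iic t, exponentialPDF r s * ENNReal.ofReal (φ s) := by
    have : expMeasure r = volume.withDensity (exponentialPDF r) := rfl
    rw [this, setLIntegral_withDensity_eq_setLIntegral_mul _ hm (by fun_prop) measurableSet_Iic]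
    rfl
  have e2 : ∫⁻ s in Iic t, exponentialPDF r s * ENNReal.ofReal (φ s) =
      ∫⁻ s in Icc 0 t, ENNReal.ofReal (r * Real.exp (-(r * s)) * φ s) := by
    rw [← lintegral_indicator measurableSet_Iic, ← lintegral_indicator measurableSet_Icc]
    refine lintegral_congr fun s => ?_
    by_cases hst : s ≤ t
    · by_cases hs : 0 ≤ s
      · rw [indicator_of_mem (mem_Iic.2 hst), indicator_of_mem (mem_Icc.2 ⟨hs, hst⟩),
          exponentialPDF_of_nonneg hs, ← ENNReal.ofReal_mul (by positivity)]
      · rw [indicator_of_mem (mem_Iic.2 hst), indicator_of_notMem (fun h => hs h.1),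
          exponentialPDF_of_neg (not_le.1 hs), zero_mul]
    · rw [indicator_of_notMem (mt mem_Iic.1 hst), indicator_of_notMem (fun h => hst h.2)]
  have hc : Continuous fun s => r * Real.exp (-(r * s)) * φ s := by fun_prop
  rw [e1, e2, ← ofReal_integral_eq_lintegral_ofReal hc.integrableOn_Icc,
    integral_Icc_eq_integral_Ioc, ← intervalIntegral.integral_of_le ht]
  refine (ae_restrict_iff' measurableSet_Icc).2 (Filter.Eventually.of_forall fun s hs => ?_)
  exact mul_nonneg (by positivity) (hφ0 s hs)

/-- Superadditivity of the lower integral needs no measurability, so none has to be established for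
`jumpProb`. -/
lemma sum_lintegral_le {α : Type*} [MeasurableSpace α] (κ : Measure α) (n : ℕ)
    (f : ℕ → α → ℝ≥0∞) :
    ∑ i ∈ Finset.range n, ∫⁻ a, f i a ∂κ ≤ ∫⁻ a, ∑ i ∈ Finset.range n, f i a ∂κ := by
  induction n with
  | zero => simp
  | succ n ih =>
    simp only [Finset.sum_range_succ]
    exact (add_le_add_left ih _).trans (le_lintegral_add _ _)

namespace WeightedGraph

open FiniteChain

variable {V : Type u} {Γ : SimpleGraph V} {μ : Sym2 V → ℝ}
variable [MeasurableSpace V] {ν : Measure V} {CD : ℕ} {CM : ℝ}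

/-- The vertices that can be reached from `x` in at most `n` steps. -/
noncomputable def IsAdmissible.reach (h : IsAdmissible Γ μ ν CD CM) : ℕ → V → Finset V
  | 0, x => {x}
  | n + 1, x => by classical exact {x} ∪ (h.neighbors x).biUnion (h.reach n)

lemma IsAdmissible.mem_reach (h : IsAdmissible Γ μ ν CD CM) (n : ℕ) (x : V) :
    x ∈ h.reach n x := by
  cases n <;> simp [reach]

lemma IsAdmissible.reach_subset (h : IsAdmissible Γ μ ν CD CM) (n : ℕ) {x y : V}
    (hxy : Γ.Adj x y) : h.reach n y ⊆ h.reach (n + 1) x := by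
  classical
  intro z hz
  simp only [reach, Finset.mem_union, Finset.mem_biUnion]
  exact Or.inr ⟨y, h.mem_neighbors.2 hxy, hz⟩

/-- The chain killed on leaving the finite set `A` dominates the paths that stay in `A`. -/
lemma IsAdmissible.sum_jumpProb_le (h : IsAdmissible Γ μ ν CD CM) (hCM : 0 < CM) [Nontrivial V]
    (A : Finset V) (y : A) (n : ℕ) :
    ∀ x : A, h.reach n x ⊆ A → ∀ t, 0 ≤ t →
      ∑ i ∈ Finset.range (n + 1), jumpProb Γ μ ν i t x y ≤
        ENNReal.ofReal (semigroup (restrictMeasure ν A) (restrictTotal Γ μ A)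
          (restrictWeight Γ μ A) t (restrictMeasure ν A y • dirac (restrictMeasure ν A) y) x) := by
  have hch := h.isChain hCM A
  set m := restrictMeasure ν A with hm
  set k := restrictTotal Γ μ A with hk
  set w := restrictWeight Γ μ A with hw
  -- This is the indicator of y, so its image under the semigroup is the killed transition
  -- probability into y.
  set f : A → ℝ := m y • dirac m y with hf
  have hf0 : ∀ x, 0 ≤ f x := fun x => mul_nonneg (hch.pos y).le (hch.dirac_nonneg y x)
  have hk0 : ∀ x, 0 < k x := fun x => h.vertexWeight_pos x
  have hr0 : ∀ x, 0 < k x / m x := fun x => div_pos (hk0 x) (hch.pos x)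
  have hzero : ∀ (x : A) t, 0 ≤ t → jumpProb Γ μ ν 0 t x y =
      ENNReal.ofReal (Real.exp (-(k x / m x * t)) * f x) := by
    intro x t ht
    by_cases hxy : x = y
    · subst hxy
      have : f x = 1 := by
        rw [hf, Pi.smul_apply, dirac_self, smul_eq_mul, mul_inv_cancel₀ (hch.pos x).ne']
      rw [this, mul_one, ← expMeasure_Ioi (hr0 x) ht, jumpProb, indicator_of_mem (mem_singleton _)]
      rfl
    · have : f x = 0 := by rw [hf, Pi.smul_apply, dirac_of_ne hxy, smul_zero]
      rw [this, mul_zero, ENNReal.ofReal_zero, jumpProb, indicator_of_notMem]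
      exact fun h' => hxy (Subtype.ext h')
  have hG0 : ∀ (x : A) t s, s ≤ t → 0 ≤ (∑ z, w x z * semigroup m k w (t - s) f z) :=
    fun x t s hs => Finset.sum_nonneg fun z _ =>
      mul_nonneg (hch.nonneg x z) (hch.semigroup_nonneg (sub_nonneg.2 hs) hf0 z)
  induction n with
  | zero =>
    intro x _ t ht
    rw [zero_add, Finset.sum_range_one, hzero x t ht, semigroup_eq_integral]
    refine ENNReal.ofReal_le_ofReal (le_add_of_nonneg_right ?_)
    refine intervalIntegral.integral_nonneg ht fun s hs => ?_
    exact mul_nonneg (Real.exp_pos _).le (div_nonneg (hG0 x t s hs.2) (hch.pos x).le)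
  | succ n ih =>
    intro x hx t ht
    have hnb : ∀ z, Γ.Adj x z → z ∈ A := fun z hz =>
      hx (h.reach_subset n hz (h.mem_reach n z))
    have step : ∀ s, s ≤ t → ∑ i ∈ Finset.range (n + 1),
        ∑' z, ENNReal.ofReal (edgeWeight Γ μ x z / vertexWeight Γ μ x) *
          jumpProb Γ μ ν i (t - s) z y ≤
        ENNReal.ofReal ((∑ z, w x z * semigroup m k w (t - s) f z) / k x) := by
      intro s hs
      have e1 : ∀ i, ∑' z, ENNReal.ofReal (edgeWeight Γ μ x z / vertexWeight Γ μ x) *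
          jumpProb Γ μ ν i (t - s) z y = ∑ z : A, ENNReal.ofReal (w x z / k x) *
            jumpProb Γ μ ν i (t - s) z y := by
        intro i
        rw [tsum_eq_sum (s := A) fun z hz => by
          rw [edgeWeight_of_not_adj fun h' => hz (hnb z h')]; simp, ← Finset.sum_coe_sort]
        rfl
      simp only [e1]
      rw [Finset.sum_comm, Finset.sum_div, ENNReal.ofReal_sum_of_nonneg fun z _ => div_nonneg
        (mul_nonneg (hch.nonneg x z) (hch.semigroup_nonneg (sub_nonneg.2 hs) hf0 z)) (hk0 x).le]
      refine Finset.sum_le_sum fun z _ => ?_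
      rw [← Finset.mul_sum]
      by_cases hz : Γ.Adj x z
      · have h1 := ih z ((h.reach_subset n hz).trans hx) (t - s) (sub_nonneg.2 hs)
        rw [mul_div_right_comm, ENNReal.ofReal_mul (div_nonneg (hch.nonneg x z) (hk0 x).le)]
        exact mul_le_mul_right h1 _
      · have : w x z = 0 := edgeWeight_of_not_adj hz
        simp [this]
    have hcont : Continuous fun s => (∑ z, w x z * semigroup m k w (t - s) f z) / k x := by
      refine Continuous.div_const ?_ _
      exact continuous_finsetSum _ fun y _ => continuous_const.mul
        ((continuous_semigroup_apply f y).comp (continuous_const.sub continuous_id))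
    -- The path without jumps gives the boundary term of the renewal equation; the other paths,
    -- split at their first jump, give its integral.
    rw [Finset.sum_range_succ', hzero x t ht]
    have main : ∑ i ∈ Finset.range (n + 1), jumpProb Γ μ ν (i + 1) t x y ≤
        ENNReal.ofReal (∫ s in (0 : ℝ)..t, Real.exp (-(k x / m x * s)) *
          ((∑ z, w x z * semigroup m k w (t - s) f z) / m x)) := by
      simp only [jumpProb]
      refine (sum_lintegral_le _ _ _).trans ?_
      refine (setLIntegral_mono' measurableSet_Iic fun s hs => step s hs).trans ?_
      have e : jumpRate Γ μ ν x = k x / m x := rfl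
      rw [e, setLIntegral_expMeasure (hr0 x) ht hcont fun s hs =>
        div_nonneg (hG0 x t s hs.2) (hk0 x).le]
      refine ENNReal.ofReal_le_ofReal (le_of_eq ?_)
      refine intervalIntegral.integral_congr fun s _ => ?_
      have := (hk0 x).ne'
      field_simp
    refine (add_le_add_left main _).trans ?_
    rw [semigroup_eq_integral t f x, add_comm, ← ENNReal.ofReal_add]
    · exact mul_nonneg (Real.exp_pos _).le (hf0 x)
    · refine intervalIntegral.integral_nonneg ht fun s hs => ?_
      exact mul_nonneg (Real.exp_pos _).le (div_nonneg (hG0 x t s hs.2) (hch.pos x).le)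

/-- A bound for the heat kernels of the chains killed outside finite sets carries over. -/
lemma IsAdmissible.heatKernel_le (h : IsAdmissible Γ μ ν CD CM) (hCM : 0 < CM) [Nontrivial V]
    {x y : V} {t b : ℝ} (ht : 0 ≤ t) (hb0 : 0 ≤ b)
    (hb : ∀ (A : Finset V) (x' y' : A), (x' : V) = x → (y' : V) = y →
      semigroup (restrictMeasure ν A) (restrictTotal Γ μ A) (restrictWeight Γ μ A) t
        (dirac (restrictMeasure ν A) x') y' ≤ b) :
    heatKernel Γ μ ν t x y ≤ b := by
  classical
  have hy := h.real_pos hCM y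
  rw [heatKernel, div_le_iff₀ hy]
  refine ENNReal.toReal_le_of_le_ofReal (by positivity) ?_
  refine ENNReal.tsum_le_of_sum_range_le fun n => ?_
  -- Adjoining y makes it a state of the finite chain even if it cannot be reached in n jumps.
  set A : Finset V := h.reach n x ∪ {y} with hA
  set x' : A := ⟨x, Finset.mem_union_left _ (h.mem_reach n x)⟩
  set y' : A := ⟨y, Finset.mem_union_right _ (Finset.mem_singleton_self y)⟩
  refine (Finset.sum_le_sum_of_subset (Finset.range_mono n.le_succ)).trans ?_
  refine (h.sum_jumpProb_le hCM A y' n x' Finset.subset_union_left t ht).trans ?_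
  refine ENNReal.ofReal_le_ofReal ?_
  rw [map_smul, Pi.smul_apply, smul_eq_mul, mul_comm, (h.isChain hCM A).heatKernel_symm]
  exact mul_le_mul_of_nonneg_right (hb A x' y' rfl rfl) hy.le

end WeightedGraph

/-! ### The first passage percolation metric and the main theorem -/

/-- Use cosh u = 1 + 2 sinh²(u/2) and sinh v ≤ v e^v for v ≥ 0. -/
lemma Real.cosh_le_one_add_sq_mul_exp (u : ℝ) :
    Real.cosh u ≤ 1 + u ^ 2 / 2 * Real.exp |u| := by
  wlog hu : 0 ≤ u generalizing u
  · have := this (-u) (by linarith)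
    rwa [Real.cosh_neg, neg_sq, abs_neg] at this
  have h0 : 0 ≤ Real.sinh (u / 2) := Real.sinh_nonneg_iff.2 (by positivity)
  have h1 : Real.sinh (u / 2) ≤ u / 2 * Real.exp (u / 2) := by
    have h2 : 1 - u ≤ Real.exp (-u) := by linarith [Real.add_one_le_exp (-u)]
    have h3 : Real.exp (u / 2) * Real.exp (-u) = Real.exp (-(u / 2)) := by
      rw [← Real.exp_add]; congr 1; ring
    rw [Real.sinh_eq, ← h3]
    nlinarith [mul_le_mul_of_nonneg_left h2 (Real.exp_pos (u / 2)).le]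
  have h4 : Real.cosh u = 1 + 2 * Real.sinh (u / 2) ^ 2 := by
    have := Real.cosh_two_mul (u / 2)
    rw [mul_div_cancel₀ u two_ne_zero, Real.cosh_sq] at this
    linarith
  have h5 : Real.sinh (u / 2) ^ 2 ≤ (u / 2 * Real.exp (u / 2)) ^ 2 := by gcongr
  have h6 : Real.exp (u / 2) ^ 2 = Real.exp u := by
    rw [← Real.exp_nat_mul]; congr 1; push_cast; ring
  rw [mul_pow, h6] at h5
  rw [h4, abs_of_nonneg hu]
  linarith

namespace WeightedGraph

open FiniteChain

variable {V : Type u} {Γ : SimpleGraph V} {μ : Sym2 V → ℝ} {CA : ℝ}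

/-- At a vertex at distance `D ≥ V_x` the two metrics are comparable. -/
lemma div_le_fppDist {lam η : ℝ} (hη : η ≤ 1) {x y : V} (hD : (1 : ℝ) ≤ Γ.dist x y)
    (hV : veryGoodRadius Γ μ CA lam η x ≤ (Γ.dist x y : ℕ∞)) :
    (Γ.dist x y : ℝ) / lam ≤ fppDist Γ μ CA x y := by
  obtain ⟨n, hn, hnD⟩ : ∃ n : ℕ, IsVeryGood Γ μ CA lam η x n ∧ n ≤ Γ.dist x y := by
    by_contra! hcon
    have : ((Γ.dist x y + 1 : ℕ) : ℕ∞) ≤ veryGoodRadius Γ μ CA lam η x :=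
      le_iInf₂ fun n hn => by exact_mod_cast hcon n hn
    have := this.trans hV
    norm_cast at this
    omega
  -- Take the centre x itself and R = r = n = D, allowed since D^η ≤ D. If d̃(x, y) < D/λ, then y
  -- would lie in the open ball B(x, D), which is absurd.
  have hgood := hn (Γ.dist x y) (by exact_mod_cast hnD) x
    (by simp only [ball, mem_ofPred_eq, SimpleGraph.dist_self, Nat.cast_zero]; linarith)
    (Γ.dist x y) (by simpa using Real.rpow_le_rpow_of_exponent_le hD hη)
    (Γ.dist x y) le_rfl
  by_contra! hlt
  have := hgood hlt
  rw [ball, mem_ofPred_eq] at this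
  exact lt_irrefl _ this

variable [MeasurableSpace V] {ν : Measure V} {CD : ℕ} {CM : ℝ}

lemma IsAdmissible.waitingTime_nonneg (h : IsAdmissible Γ μ ν CD CM) (hCA : 0 < CA) {e : Sym2 V}
    (he : e ∈ Γ.edgeSet) : 0 ≤ waitingTime μ CA e :=
  le_min hCA.le (Real.rpow_nonneg (h.weight_pos e he).le _)

lemma IsAdmissible.sum_waitingTime_nonneg (h : IsAdmissible Γ μ ν CD CM) (hCA : 0 < CA) {x y : V}
    (p : Γ.Walk x y) : 0 ≤ (p.edges.map (waitingTime μ CA)).sum := by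
  refine List.sum_nonneg fun a ha => ?_
  obtain ⟨e, he, rfl⟩ := List.mem_map.1 ha
  exact h.waitingTime_nonneg hCA (p.edges_subset_edgeSet he)

lemma IsAdmissible.fppDist_le (h : IsAdmissible Γ μ ν CD CM) (hCA : 0 < CA) {x y : V}
    (p : Γ.Walk x y) : fppDist Γ μ CA x y ≤ (p.edges.map (waitingTime μ CA)).sum :=
  ciInf_le ⟨0, by rintro _ ⟨p, rfl⟩; exact h.sum_waitingTime_nonneg hCA p⟩ p

lemma IsAdmissible.fppDist_self (h : IsAdmissible Γ μ ν CD CM) (hCA : 0 < CA) (x : V) :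
    fppDist Γ μ CA x x = 0 := by
  refine le_antisymm ?_ (Real.iInf_nonneg fun p => h.sum_waitingTime_nonneg hCA p)
  simpa using h.fppDist_le hCA (SimpleGraph.Walk.nil : Γ.Walk x x)

lemma IsAdmissible.fppDist_le_add (h : IsAdmissible Γ μ ν CD CM) (hCA : 0 < CA) (x y z : V) :
    fppDist Γ μ CA x y ≤ fppDist Γ μ CA x z + fppDist Γ μ CA y z := by
  have := h.connected.preconnected
  have : Nonempty (Γ.Walk x z) := this x z
  have : Nonempty (Γ.Walk y z) := h.connected.preconnected y z
  refine le_ciInf_add_ciInf fun p q => ?_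
  refine (h.fppDist_le hCA (p.append q.reverse)).trans (le_of_eq ?_)
  simp [SimpleGraph.Walk.edges_append, SimpleGraph.Walk.edges_reverse, List.sum_reverse]

lemma IsAdmissible.fppDist_le_of_adj (h : IsAdmissible Γ μ ν CD CM) (hCA : 0 < CA) (x : V)
    {a b : V} (hab : Γ.Adj a b) :
    fppDist Γ μ CA x b ≤ fppDist Γ μ CA x a + waitingTime μ CA s(a, b) := by
  have : Nonempty (Γ.Walk x a) := h.connected.preconnected x a
  rw [← sub_le_iff_le_add]
  refine le_ciInf fun p => ?_
  rw [sub_le_iff_le_add]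
  refine (h.fppDist_le hCA (p.concat hab)).trans (le_of_eq ?_)
  simp [SimpleGraph.Walk.edges_concat]

lemma IsAdmissible.abs_fppDist_sub_le (h : IsAdmissible Γ μ ν CD CM) (hCA : 0 < CA) (x : V)
    {a b : V} (hab : Γ.Adj a b) :
    |fppDist Γ μ CA x a - fppDist Γ μ CA x b| ≤ waitingTime μ CA s(a, b) := by
  have h1 := h.fppDist_le_of_adj hCA x hab
  have h2 := h.fppDist_le_of_adj hCA x hab.symm
  rw [Sym2.eq_swap] at h2
  exact abs_sub_le_iff.2 ⟨by linarith, by linarith⟩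

/-- The bound M^(-1/2) gives M δ² ≤ 1, and the bound `CA` controls the exponential in the estimate
of cosh; the error is thus independent of the conductance M. -/
lemma weight_mul_cosh_le {M δ s : ℝ} (hM : 0 < M) (hs : 0 ≤ s)
    (hδ : |δ| ≤ min CA (M ^ (-(1 / 2) : ℝ))) :
    M * Real.cosh (s * δ) ≤ M + s ^ 2 * Real.exp (s * CA) := by
  have h1 : |δ| ≤ CA := hδ.trans (min_le_left _ _)
  have h2 : |δ| ≤ M ^ (-(1 / 2) : ℝ) := hδ.trans (min_le_right _ _)
  have h3 : M * δ ^ 2 ≤ 1 := by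
    have e : (M ^ (-(1 / 2) : ℝ)) ^ 2 = M⁻¹ := by
      rw [← Real.rpow_natCast, ← Real.rpow_mul hM.le, ← Real.rpow_neg_one]
      norm_num
    calc M * δ ^ 2 = M * |δ| ^ 2 := by rw [sq_abs]
      _ ≤ M * (M ^ (-(1 / 2) : ℝ)) ^ 2 := by gcongr
      _ = 1 := by rw [e, mul_inv_cancel₀ hM.ne']
  have h4 : Real.exp |s * δ| ≤ Real.exp (s * CA) := by
    rw [abs_mul, abs_of_nonneg hs]
    gcongr
  calc M * Real.cosh (s * δ) ≤ M * (1 + (s * δ) ^ 2 / 2 * Real.exp |s * δ|) := by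
        gcongr
        exact Real.cosh_le_one_add_sq_mul_exp _
    _ = M + s ^ 2 * (M * δ ^ 2) / 2 * Real.exp |s * δ| := by ring
    _ ≤ M + s ^ 2 * 1 / 2 * Real.exp (s * CA) := by gcongr
    _ ≤ M + s ^ 2 * Real.exp (s * CA) := by
        have : 0 ≤ s ^ 2 * Real.exp (s * CA) := by positivity
        linarith

/-- The first passage percolation metric is intrinsic for the chain. -/
lemma IsAdmissible.sum_weight_mul_cosh_le (h : IsAdmissible Γ μ ν CD CM) (hCA : 0 < CA)
    (hCM : 0 < CM) (x₀ : V) (A : Finset V) {s : ℝ} (hs : 0 ≤ s) (x : A) :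
    ∑ y, restrictWeight Γ μ A x y *
        Real.cosh (s * (fppDist Γ μ CA x₀ (x : V) - fppDist Γ μ CA x₀ (y : V))) ≤
      restrictTotal Γ μ A x +
        (CD * CM + 1) * s ^ 2 * Real.exp (s * CA) * restrictMeasure ν A x := by
  classical
  set E : ℝ := s ^ 2 * Real.exp (s * CA) with hE
  have hE0 : 0 ≤ E := by positivity
  have hterm : ∀ y : A, restrictWeight Γ μ A x y *
      Real.cosh (s * (fppDist Γ μ CA x₀ (x : V) - fppDist Γ μ CA x₀ (y : V))) ≤
      edgeWeight Γ μ x y + if Γ.Adj x y then E else 0 := by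
    intro y
    rw [restrictWeight]
    by_cases hxy : Γ.Adj x y
    · rw [if_pos hxy, edgeWeight_of_adj hxy]
      exact weight_mul_cosh_le (h.weight_pos _ (Γ.mem_edgeSet.2 hxy)) hs
        (h.abs_fppDist_sub_le hCA x₀ hxy)
    · rw [if_neg hxy, edgeWeight_of_not_adj hxy, zero_mul, zero_add]
  refine (Finset.sum_le_sum fun y _ => hterm y).trans ?_
  rw [Finset.sum_add_distrib]
  have h1 : ∑ y : A, edgeWeight Γ μ x y ≤ restrictTotal Γ μ A x := by
    rw [Finset.sum_coe_sort A fun y => edgeWeight Γ μ x y]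
    exact h.sum_le_vertexWeight x A
  have h2 : (∑ y : A, if Γ.Adj x y then E else 0) ≤ CD * E := by
    rw [Finset.sum_coe_sort A fun y => if Γ.Adj x y then E else 0, ← Finset.sum_filter,
      Finset.sum_const, nsmul_eq_mul]
    refine mul_le_mul_of_nonneg_right ?_ hE0
    have : (A.filter fun y => Γ.Adj x y).card ≤ (h.neighbors x).card :=
      Finset.card_le_card fun y hy => h.mem_neighbors.2 (Finset.mem_filter.1 hy).2
    exact_mod_cast this.trans (h.card_neighbors_le x)
  have h3 : 1 ≤ CM * restrictMeasure ν A x := by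
    have := mul_le_mul_of_nonneg_left (h.inv_le_real (x : V)) hCM.le
    rwa [mul_inv_cancel₀ hCM.ne'] at this
  -- The factor `CM` absorbs the lower bound on ν; the extra 1 keeps the constant positive even for
  -- `CD = 0`.
  have h4 : CD * E ≤ (CD * CM + 1) * s ^ 2 * Real.exp (s * CA) * restrictMeasure ν A x := by
    have h5 : 0 < restrictMeasure ν A x := h.real_pos hCM x
    calc (CD : ℝ) * E = CD * E * 1 := by ring
      _ ≤ CD * E * (CM * restrictMeasure ν A x) := by gcongr
      _ ≤ CD * E * (CM * restrictMeasure ν A x) + E * restrictMeasure ν A x := by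
          have : 0 ≤ E * restrictMeasure ν A x := by positivity
          linarith
      _ = _ := by rw [hE]; ring
  linarith

end WeightedGraph

/-! ### Heat kernel bounds on the infinite graph in the first passage metric -/

namespace WeightedGraph

open FiniteChain

variable {V : Type u} {Γ : SimpleGraph V} {μ : Sym2 V → ℝ}
variable [MeasurableSpace V] {ν : Measure V} {CD : ℕ} {CM CA : ℝ}

lemma IsAdmissible.heatKernel_le_exp (h : IsAdmissible Γ μ ν CD CM) (hCA : 0 < CA) (hCM : 0 < CM)
    [Nontrivial V] {x y : V} {t s r : ℝ} (ht : 0 ≤ t) (hs : 0 ≤ s)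
    (hr : r ≤ fppDist Γ μ CA x y) :
    heatKernel Γ μ ν t x y ≤
      CM * Real.exp (-(s * r) + (CD * CM + 1) * s ^ 2 * Real.exp (s * CA) * t) := by
  refine h.heatKernel_le hCM ht (by positivity) fun A x' y' hx hy => ?_
  subst hx hy
  refine ((h.isChain hCM A).heatKernel_le_exp (M := CM) (fun z => h.inv_real_le hCM z)
    (ρ := fun z => fppDist Γ μ CA x' z) hs (h.sum_weight_mul_cosh_le hCA hCM x' A hs) ht
    (h.fppDist_self hCA x')).trans ?_
  gcongr

lemma IsAdmissible.heatKernel_diag_le [DiscreteMeasurableSpace V] (h : IsAdmissible Γ μ ν CD CM)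
    (hCM : 0 < CM) [Nontrivial V] {d CV CN : ℝ} (hd : 1 ≤ d) (hCN : 0 < CN)
    (hN : WeightedGraph.IsNash Γ μ ν d CV CN) (x y : V) {t : ℝ} (ht : 0 < t) :
    heatKernel Γ μ ν t x y ≤ 2 * ((4 * CN / d) ^ (-(d / 2)) * (t / 2) ^ (-(d / 2))) := by
  refine h.heatKernel_le hCM ht.le (by positivity) fun A x' y' _ _ => ?_
  have := (h.isChain hCM A).heatKernel_diag_le hd hCN (h.isNash hCM hd hCN hN A) (half_pos ht) x' y'
  rwa [add_halves] at this

/-- The Gaussian bound in terms of the first passage percolation metric. -/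
theorem exists_heatKernel_le_gaussian (CD : ℕ) {CM CA d CV CN a : ℝ} (hCM : 0 < CM) (hCA : 0 < CA)
    (hd : 1 ≤ d) (hCN : 0 < CN) (ha : 0 < a) :
    ∃ B c : ℝ, 0 < B ∧ 0 < c ∧ ∀ (V : Type u) [Nontrivial V] [MeasurableSpace V]
      [DiscreteMeasurableSpace V] (Γ : SimpleGraph V) (μ : Sym2 V → ℝ) (ν : Measure V),
      IsAdmissible Γ μ ν CD CM → WeightedGraph.IsNash Γ μ ν d CV CN →
      ∀ (x y : V) (t R : ℝ), 0 < t → 0 ≤ R → R ≤ a * t → R ≤ fppDist Γ μ CA x y →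
        heatKernel Γ μ ν t x y ≤ B * t ^ (-(d / 2)) * Real.exp (-(c * (R ^ 2 / t))) := by
  obtain ⟨B, c, hB, hc, H⟩ := FiniteChain.exists_gaussian_bound.{u} (K := CD * CM + 1)
    (by positivity) hCA hCN hCM hd ha
  refine ⟨B * 2 ^ (d / 2), c / 2, by positivity, by positivity, ?_⟩
  intro V _ _ _ Γ μ ν h hN x y t R ht hR hRt hRd
  refine h.heatKernel_le hCM ht.le (by positivity) fun A x' y' hx hy => ?_
  subst hx hy
  -- Half the distance and half the time: d̃(x, z) + d̃(y, z) ≥ d̃(x, y) ≥ R is the condition on the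
  -- two far sets.
  have key := H A _ _ _ (h.isChain hCM A) (fun z => h.inv_real_le hCM z)
    (h.isNash hCM hd hCN hN A) x' y' (fun z => fppDist Γ μ CA x' z)
    (fun z => fppDist Γ μ CA y' z) (h.fppDist_self hCA x') (h.fppDist_self hCA y')
    (fun s hs => h.sum_weight_mul_cosh_le hCA hCM x' A hs)
    (fun s hs => h.sum_weight_mul_cosh_le hCA hCM y' A hs) (R / 2) (t / 2) (half_pos ht)
    (by positivity) (by linarith)
    (fun z => by linarith [h.fppDist_le_add hCA (x' : V) y' z])
  rw [add_halves] at key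
  refine key.trans (le_of_eq ?_)
  rw [Real.div_rpow ht.le two_pos.le, Real.rpow_neg two_pos.le, div_inv_eq_mul]
  have e : c * ((R / 2) ^ 2 / (t / 2)) = c / 2 * (R ^ 2 / t) := by field_simp
  rw [e]
  ring

end WeightedGraph

theorem theorem2p19 (CA CM d CV CN lam η : ℝ) (CD : ℕ)
    (hCA : 0 < CA) (hCM : 1 ≤ CM) (hd : 1 ≤ d) (hCN : 0 < CN)
    (hlam : 1 ≤ lam) (hη : 0 < η) (hη' : η < 1) :
    ∃ c₁ c₂ c₃ c₄ : ℝ, 0 < c₁ ∧ 0 < c₂ ∧ 0 < c₃ ∧ 0 < c₄ ∧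
      ∀ (V : Type u) [Infinite V] [MeasurableSpace V] [DiscreteMeasurableSpace V]
        (Γ : SimpleGraph V) (μ : Sym2 V → ℝ) (ν : Measure V),
        WeightedGraph.IsAdmissible Γ μ ν CD CM →
        WeightedGraph.IsNash Γ μ ν d CV CN →
        ∀ (x y : V) (t : ℝ), 0 < t →
          ((c₁ ≤ (Γ.dist x y : ℝ) ∧
              WeightedGraph.veryGoodRadius Γ μ CA lam η x ≤ (Γ.dist x y : ℕ∞)) ∨
            (Γ.dist x y : ℝ) ^ 2 ≤ t) →
          (c₂ * (Γ.dist x y : ℝ) ≤ t →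
            WeightedGraph.heatKernel Γ μ ν t x y ≤
              c₃ * t ^ (-(d / 2)) * Real.exp (-(c₄ * (Γ.dist x y : ℝ) ^ 2 / t))) ∧
          (t ≤ c₂ * (Γ.dist x y : ℝ) →
            WeightedGraph.heatKernel Γ μ ν t x y ≤
              c₃ * Real.exp (-(c₄ * (Γ.dist x y : ℝ) *
                max 1 (Real.log ((Γ.dist x y : ℝ) / t))))) := by
  have hCM0 : 0 < CM := by linarith
  have hlam0 : 0 < lam := by linarith
  set K : ℝ := CD * CM + 1 with hK
  have hK0 : 0 < K := by positivity
  -- For t ≤ c₂ D the first entry forces log(D/t) ≥ 1, the second 2λK ≤ (D/t)^(1/2), which makes the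
  -- Davies error at most half of the decay.
  set c₂ : ℝ := min (Real.exp (-1)) (1 / (2 * lam * K) ^ 2) with hc₂
  have hc₂0 : 0 < c₂ := lt_min (Real.exp_pos _) (by positivity)
  have hc₂e : c₂ ≤ Real.exp (-1) := min_le_left _ _
  have hc₂K : c₂ ≤ 1 / (2 * lam * K) ^ 2 := min_le_right _ _
  have hc₂1 : c₂ < 1 := hc₂e.trans_lt (Real.exp_lt_one_iff.2 (by norm_num))
  obtain ⟨B, c, hB, hc, H⟩ := WeightedGraph.exists_heatKernel_le_gaussian.{u} CD (CV := CV)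
    hCM0 hCA hd hCN (inv_pos.2 hc₂0)
  set C₁ : ℝ := 2 * ((4 * CN / d) ^ (-(d / 2)) * 2 ^ (d / 2)) with hC₁
  have hC₁0 : 0 < C₁ := by positivity
  set c₄ : ℝ := min (c / lam ^ 2) (1 / (4 * lam * (CA + 1))) with hc₄
  have hc₄0 : 0 < c₄ := lt_min (by positivity) (by positivity)
  have hc₄c : c₄ ≤ c / lam ^ 2 := min_le_left _ _
  have hc₄A : c₄ ≤ 1 / (4 * lam * (CA + 1)) := min_le_right _ _
  -- The summands serve the Gaussian case, the case t ≥ D² (where e^(c₄) pays for the Gaussian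
  -- factor), and part (b).
  set c₃ : ℝ := B + C₁ * Real.exp c₄ + CM with hc₃
  have hp : 0 < C₁ * Real.exp c₄ := by positivity
  have hc₃0 : 0 < c₃ := by positivity
  clear_value c₄ C₁ c₂ K
  -- The choice c₁ = 1 suffices, since D ≥ 1 is needed only for D^η ≤ D.
  refine ⟨1, c₂, c₃, c₄, one_pos, hc₂0, hc₃0, hc₄0, ?_⟩
  intro V _ _ _ Γ μ ν h hN x y t ht hcase
  set D : ℝ := (Γ.dist x y : ℝ) with hD
  have hD0 : 0 ≤ D := Nat.cast_nonneg _
  have htpow : 0 < t ^ (-(d / 2)) := Real.rpow_pos_of_pos ht _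
  refine ⟨fun hDt => ?_, fun htD => ?_⟩
  · rcases hcase with ⟨hD1, hV⟩ | hDt2
    · have hfpp := WeightedGraph.div_le_fppDist hη'.le hD1 hV
      have hR : D / lam ≤ c₂⁻¹ * t := by
        refine (div_le_self hD0 hlam).trans ?_
        rw [inv_mul_eq_div, le_div_iff₀ hc₂0]
        linarith
      refine (H V Γ μ ν h hN x y t (D / lam) ht (by positivity) hR hfpp).trans ?_
      have h1 : c₄ * D ^ 2 / t ≤ c * ((D / lam) ^ 2 / t) := by
        calc c₄ * D ^ 2 / t ≤ c / lam ^ 2 * D ^ 2 / t := by gcongr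
          _ = c * ((D / lam) ^ 2 / t) := by ring
      have h2 : B ≤ c₃ := by linarith
      gcongr
    · refine (h.heatKernel_diag_le hCM0 hd hCN hN x y ht).trans ?_
      have h1 : 1 ≤ Real.exp c₄ * Real.exp (-(c₄ * D ^ 2 / t)) := by
        rw [← Real.exp_add]
        refine Real.one_le_exp ?_
        have : c₄ * D ^ 2 / t ≤ c₄ := by
          rw [div_le_iff₀ ht]
          gcongr
        linarith
      have h2 : C₁ * Real.exp c₄ ≤ c₃ := by linarith
      rw [Real.div_rpow ht.le two_pos.le, Real.rpow_neg two_pos.le (d / 2), div_inv_eq_mul]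
      calc 2 * ((4 * CN / d) ^ (-(d / 2)) * (t ^ (-(d / 2)) * 2 ^ (d / 2)))
          = C₁ * t ^ (-(d / 2)) * 1 := by rw [hC₁]; ring
        _ ≤ C₁ * t ^ (-(d / 2)) * (Real.exp c₄ * Real.exp (-(c₄ * D ^ 2 / t))) := by gcongr
        _ = C₁ * Real.exp c₄ * t ^ (-(d / 2)) * Real.exp (-(c₄ * D ^ 2 / t)) := by ring
        _ ≤ _ := by gcongr
  · have hDpos : 0 < D := by
      by_contra! hneg
      nlinarith
    have hDone : 1 ≤ D := by
      rw [hD, Nat.cast_pos] at hDpos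
      rw [hD, Nat.one_le_cast]
      exact hDpos
    rcases hcase with ⟨-, hV⟩ | hDt2
    · have hfpp := WeightedGraph.div_le_fppDist hη'.le hDone hV
      set L : ℝ := Real.log (D / t) with hL
      have hDt : 1 / c₂ ≤ D / t := by
        rw [div_le_div_iff₀ hc₂0 ht]
        linarith
      have hexpL : Real.exp L = D / t := Real.exp_log (by positivity)
      have hL1 : 1 ≤ L := by
        rw [hL, Real.le_log_iff_exp_le (by positivity)]
        refine le_trans ?_ hDt
        rw [le_div_iff₀ hc₂0, ← le_div_iff₀' (Real.exp_pos _), one_div, ← Real.exp_neg]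
        exact hc₂e
      -- Chosen so that s e^(s C_A) ≤ e^(s(1 + C_A)) = e^(L/2) = (D/t)^(1/2). The second such
      -- factor, from c₂, then turns t into D.
      set s : ℝ := L / (2 * (CA + 1)) with hs
      have hs0 : 0 ≤ s := by positivity
      have hkey : K * s ^ 2 * Real.exp (s * CA) * t ≤ s * (D / lam) / 2 := by
        have h1 : s * Real.exp (s * CA) ≤ Real.exp (L / 2) := by
          have h2 : s ≤ Real.exp s := by linarith [Real.add_one_le_exp s]
          calc s * Real.exp (s * CA) ≤ Real.exp s * Real.exp (s * CA) := by gcongr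
            _ = Real.exp (L / 2) := by
              rw [← Real.exp_add]
              congr 1
              rw [hs]
              field_simp
              ring
        have h3 : 2 * lam * K ≤ Real.exp (L / 2) := by
          refine abs_le_of_sq_le_sq' ?_ (Real.exp_pos _).le |>.2
          rw [← Real.exp_nat_mul, Nat.cast_ofNat, mul_div_cancel₀ L two_ne_zero, hexpL]
          refine le_trans ?_ hDt
          rwa [le_div_iff₀ hc₂0, ← le_div_iff₀' (by positivity)]
        have h4 : Real.exp (L / 2) * Real.exp (L / 2) * t = D := by
          rw [← Real.exp_add, add_halves, hexpL, div_mul_cancel₀ _ ht.ne']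
        calc K * s ^ 2 * Real.exp (s * CA) * t
            = (2 * lam * K) * s * (s * Real.exp (s * CA)) * t / (2 * lam) := by
              field_simp
          _ ≤ Real.exp (L / 2) * s * Real.exp (L / 2) * t / (2 * lam) := by gcongr
          _ = s * (Real.exp (L / 2) * Real.exp (L / 2) * t) / (2 * lam) := by ring
          _ = s * (D / lam) / 2 := by rw [h4]; field_simp
      refine (h.heatKernel_le_exp hCA hCM0 ht.le hs0 hfpp).trans ?_
      rw [max_eq_right hL1, ← hK]
      have h5 : c₄ * D * L ≤ s * (D / lam) / 2 := by
        calc c₄ * D * L ≤ 1 / (4 * lam * (CA + 1)) * D * L := by gcongr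
          _ = s * (D / lam) / 2 := by rw [hs]; field_simp; norm_num
      have h6 : CM ≤ c₃ := by linarith
      refine mul_le_mul h6 (Real.exp_le_exp.2 ?_) (Real.exp_pos _).le hc₃0.le
      linarith
    -- Here D² ≤ t ≤ c₂ D with c₂ < 1, against D ≥ 1.
    · exfalso
      nlinarith
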